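/- An arena $\mathcal A=\langle S,\Sigma_E,\Sigma_A,\delta,\sim_E,\sim_A\rangle$ consists of a finite set $S$ of states, finite non-empty sets $\Sigma_E,\Sigma_A$ of actions of Eve and Adam, a map $\delta$ from $S\times\Sigma_E\times\Sigma_A$ to the probability distributions on $S$, and two equivalence relations on $S$; Adam is perfectly informed if $\sim_A$ is equality. A play proceeds in rounds: in state $s$ the players simultaneously choose $\sigma_E,\sigma_A$, and the next state is drawn from $\delta(s,\sigma_E,\sigma_A)$. A (pure, observation-based) strategy of Eve is a map $\varphi:(S/_{\sim_E})^*\to\Sigma_E$, applied to the sequence of $\sim_E$-classes of the states visited so far, and similarly for Adam with $\sim_A$. For $K,F\subseteq S$, $\varphi$ is positively winning in the reachability game $(\mathcal A,K,F)$ if for every $s_0\in K$ and every strategy $\psi$ of Adam the play from $s_0$ under $(\varphi,\psi)$ visits $F$ with positive probability. Let $\mathcal T=\langle Q,\Sigma_E\times S/_{\sim_E},q_0,q_s,\delta_{\mathcal T},Act\rangle$ be a deterministic finite automaton with initial state $q_0$, sink state $q_s$, transition function $\delta_{\mathcal T}:Q\times(\Sigma_E\times S/_{\sim_E})\to Q$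 and $Act:Q\to 2^{\Sigma_E}$ such that $Act(q)=\emptyset$ iff $q=q_s$, and $\delta_{\mathcal T}(q,(\sigma,x))=q_s$ iff $\sigma\notin Act(q)$. For a partial play $\lambda$ (a finite sequence $s_0(\sigma_E^0,\sigma_A^0)s_1\cdots s_k$ with $\delta(s_i,\sigma_E^i,\sigma_A^i)(s_{i+1})>0$ for all $i<k$) let $q_\lambda$ be the state that $\mathcal T$ reaches from $q_0$ by reading $(\sigma_E^0,[s_1]_{\sim_E})\cdots(\sigma_E^{k-1},[s_k]_{\sim_E})$. A strategy $\varphi$ of Eve is $\mathcal T$-compatible in the game if $\varphi([s_0]_{\sim_E}\cdots[s_k]_{\sim_E})\in Act(q_\lambda)$ for every partial play $\lambda=s_0(\sigma_E^0,\sigma_A^0)s_1\cdots s_k$ with $s_0\in K$ in which Eve respects $\varphi$, i.e. $\sigma_E^i=\varphi([s_0]_{\sim_E}\cdots[s_i]_{\sim_E})$ for all $i<k$. Theorem. Consider inputs consisting of an arena $\mathcal A$ with rational transition probabilities in which Adam is perfectly informed, an automaton $\mathcal T$ as above, and sets $K,F\subseteq S$. One can decide, in time polynomial in $2^{|S|}$,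 $|Q|$, $|\Sigma_E|$ and $|\Sigma_A|$, whether Eve has a $\mathcal T$-compatible strategy that is positively winning in $(\mathcal A,K,F)$. If such a strategy exists, one can construct, within a time bound of the same kind, one that is computed by a finite automaton with output (reading the sequence of $\sim_E$-classes and outputting Eve's next action) whose number of states is bounded by a polynomial in $|Q|$ and $2^{|S|}$; this polynomial does not depend on the input. Time is the number of elementary operations of a program that works on binary trees (list structures): building a pair, taking a component of a pair, and testing for nil; the input is given as such a structure. -/

import Mathlib

/-! # Concurrent stochastic games with imperfect information -/

namespace ConcurrentGame

open MeasureTheory ProbabilityTheory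

/-- A concurrent arena with imperfect information, with states `S`, actions `E` for Eve and
actions `A` for Adam. `PMF S` is the type of probability distributions on `S`. -/
structure Arena (S E A : Type) where
  /-- the (total) transition function -/
  δ : S → E → A → PMF S
  /-- indistinguishability for Eve -/
  simE : Setoid S
  /-- indistinguishability for Adam -/
  simA : Setoid S

/-- One round `s (σ_E, σ_A)` of a play: a state and the actions chosen in that state. -/
structure Round (S E A : Type) where
  state : S
  eve : E
  adam : A

/-- All subsets of the (finite) set of rounds are measurable. -/
instance (S E A : Type) : MeasurableSpace (Round S E A) := ⊤

instance (S E A : Type) : DiscreteMeasurableSpace (Round S E A) := ⟨fun _ => trivial⟩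

instance (S E A : Type) [Finite S] [Finite E] [Finite A] : Finite (Round S E A) :=
  Finite.of_injective (fun r : Round S E A => (r.state, r.eve, r.adam)) (by
    rintro ⟨s, e, a⟩ ⟨s', e', a'⟩ h
    simpa using h)

/-- Infinite sequences `s₀ (σ_E⁰, σ_A⁰) s₁ (σ_E¹, σ_A¹) s₂ ⋯`. The σ-algebra is the product
σ-algebra, that is, the one generated by the cones. -/
abbrev PlaySeq (S E A : Type) := ℕ → Round S E A

namespace Arena

variable {S E A : Type} (𝒜 : Arena S E A)

/-- The observations of Eve: classes of `∼_E`. -/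
abbrev ObsE := Quotient 𝒜.simE

/-- The observations of Adam: classes of `∼_A`. -/
abbrev ObsA := Quotient 𝒜.simA

/-- Adam is perfectly informed if `∼_A` is the equality relation. -/
def AdamPerfectlyInformed : Prop := ∀ s t : S, 𝒜.simA s t ↔ s = t

/-- Observation-based pure strategies of Eve; the observations are listed from the first one
to the current one. -/
abbrev StrategyE := List 𝒜.ObsE → E

/-- Observation-based pure strategies of Adam. -/
abbrev StrategyA := List 𝒜.ObsA → A

/-- The round played in state `s` after the sequence of states `h`. -/
def roundAfter (φ : 𝒜.StrategyE) (ψ : 𝒜.StrategyA) (h : List S) (s : S) : Round S E A where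
  state := s
  eve := φ ((h ++ [s]).map (Quotient.mk 𝒜.simE))
  adam := ψ ((h ++ [s]).map (Quotient.mk 𝒜.simA))

/-- The sequence of states of a finite sequence of rounds. -/
def statesOf {n : ℕ} (h : (i : Finset.Iic n) → Round S E A) : List S :=
  List.ofFn fun i : Fin (n + 1) =>
    (h ⟨i, Finset.mem_Iic.2 (Nat.lt_succ_iff.1 i.isLt)⟩).state

/-- The distribution of round `n + 1` given the rounds `0, …, n`: the next state is drawn from
`δ`, and both players then apply their strategies. -/
noncomputable def nextRound (φ : 𝒜.StrategyE) (ψ : 𝒜.StrategyA) {n : ℕ}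
    (h : (i : Finset.Iic n) → Round S E A) : PMF (Round S E A) :=
  let r := h ⟨n, Finset.mem_Iic.2 le_rfl⟩
  (𝒜.δ r.state r.eve r.adam).map (𝒜.roundAfter φ ψ (statesOf h))

/-- `nextRound` as a Markov kernel. -/
noncomputable def kernel [Finite S] [Finite E] [Finite A] (φ : 𝒜.StrategyE) (ψ : 𝒜.StrategyA)
    (n : ℕ) : Kernel ((i : Finset.Iic n) → Round S E A) (Round S E A) :=
  Kernel.ofFunOfCountable fun h => (𝒜.nextRound φ ψ h).toMeasure

instance [Finite S] [Finite E] [Finite A] (φ : 𝒜.StrategyE) (ψ : 𝒜.StrategyA) (n : ℕ) :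
    IsMarkovKernel (𝒜.kernel φ ψ n) :=
  ⟨fun h => PMF.toMeasure.isProbabilityMeasure (𝒜.nextRound φ ψ h)⟩

/-- The probability measure on plays from the initial state `s₀` when Eve uses `φ` and Adam
uses `ψ` (obtained from the Ionescu-Tulcea theorem). -/
noncomputable def prob [Finite S] [Finite E] [Finite A] (s₀ : S) (φ : 𝒜.StrategyE)
    (ψ : 𝒜.StrategyA) : Measure (PlaySeq S E A) :=
  Kernel.traj (X := fun _ => Round S E A) (𝒜.kernel φ ψ) 0 fun _ => 𝒜.roundAfter φ ψ [] s₀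

instance [Finite S] [Finite E] [Finite A] (s₀ : S) (φ : 𝒜.StrategyE) (ψ : 𝒜.StrategyA) :
    IsProbabilityMeasure (𝒜.prob s₀ φ ψ) := by
  unfold prob
  infer_instance

/-- The reachability objective: some state of the play is final. -/
def reach (F : Set S) : Set (PlaySeq S E A) := {π | ∃ n, (π n).state ∈ F}

/-- `φ` is positively winning in the reachability game `(𝒜, K, F)`, in which Adam first picks the
initial state in `K`. -/
def PositivelyWinning [Finite S] [Finite E] [Finite A] (K F : Set S) (φ : 𝒜.StrategyE) : Prop :=
  ∀ s₀ ∈ K, ∀ ψ : 𝒜.StrategyA, 0 < 𝒜.prob s₀ φ ψ (reach F)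

end Arena

/-- Finite alternating sequences `s₀ (σ_E⁰, σ_A⁰) s₁ ⋯ s_k`. -/
inductive PartialPlay (S E A : Type) where
  | start (s₀ : S) : PartialPlay S E A
  | step (lam : PartialPlay S E A) (σE : E) (σA : A) (s : S) : PartialPlay S E A

namespace PartialPlay

variable {S E A : Type}

/-- The first state. -/
def first : PartialPlay S E A → S
  | start s₀ => s₀
  | step lam _ _ _ => lam.first

/-- The last state. -/
def last : PartialPlay S E A → S
  | start s₀ => s₀
  | step _ _ _ s => s

/-- The sequence of states. -/
def states : PartialPlay S E A → List S
  | start s₀ => [s₀]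
  | step lam _ _ s => lam.states ++ [s]

end PartialPlay

namespace Arena

variable {S E A : Type} (𝒜 : Arena S E A)

/-- The sequence of observations of Eve along a partial play. -/
def obsE (lam : PartialPlay S E A) : List 𝒜.ObsE := lam.states.map (Quotient.mk 𝒜.simE)

/-- All the transitions of the sequence have positive probability, so that it is a partial play
of the arena. -/
def IsPartialPlay : PartialPlay S E A → Prop
  | .start _ => True
  | .step lam σE σA s => IsPartialPlay lam ∧ 0 < 𝒜.δ lam.last σE σA s

/-- Eve respects `φ` along the partial play. -/
def EveRespects (φ : 𝒜.StrategyE) : PartialPlay S E A → Prop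
  | .start _ => True
  | .step lam σE _ _ => EveRespects φ lam ∧ σE = φ (𝒜.obsE lam)

end Arena

/-- A deterministic automaton with states `Q` that reads the actions and the observations of Eve
and restricts her next actions. -/
structure ActionAutomaton {S E A : Type} (𝒜 : Arena S E A) (Q : Type) where
  /-- the initial state -/
  q₀ : Q
  /-- the sink state -/
  qs : Q
  /-- the transition function -/
  δ : Q → E → 𝒜.ObsE → Q
  /-- the admissible actions -/
  act : Q → Set E
  act_eq_empty_iff : ∀ q, act q = ∅ ↔ q = qs
  δ_eq_sink_iff : ∀ q σ x, δ q σ x = qs ↔ σ ∉ act q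

namespace ActionAutomaton

variable {S E A Q : Type} {𝒜 : Arena S E A} (T : ActionAutomaton 𝒜 Q)

/-- The state `q_λ` that `T` reaches along the partial play `λ`. -/
def run : PartialPlay S E A → Q
  | .start _ => T.q₀
  | .step lam σE _ s => T.δ (run lam) σE (Quotient.mk 𝒜.simE s)

/-- `φ` is `T`-compatible in a game with set `K` of initial states: along every partial play that
starts in `K` and where Eve respects `φ`, her next action is admissible. -/
def Compatible (K : Set S) (φ : 𝒜.StrategyE) : Prop :=
  ∀ lam : PartialPlay S E A, lam.first ∈ K → 𝒜.IsPartialPlay lam → 𝒜.EveRespects φ lam →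
    φ (𝒜.obsE lam) ∈ T.act (T.run lam)

end ActionAutomaton

/-- A finite automaton with output that reads a sequence of observations and outputs the next
action; its states are `0, …, size - 1`. -/
structure FiniteMemory (Obs E : Type) where
  size : ℕ
  init : Fin size
  next : Fin size → Obs → Fin size
  out : Fin size → E

/-- The strategy computed by a finite automaton with output. -/
def FiniteMemory.strategy {Obs E : Type} (M : FiniteMemory Obs E) (w : List Obs) : E :=
  M.out (w.foldl M.next M.init)

end ConcurrentGame

/-! # Programs and their running time

A WHILE language over binary trees (LISP-style lists): programs have finitely many variables,
each holding a tree, and the elementary operations are building a pair, taking a component of a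
pair, and testing for `nil`. Each of them costs one unit of time. -/

namespace WhileLang

/-- Binary trees. -/
inductive Data where
  | nil : Data
  | cons (l r : Data) : Data

/-- First component; `nil` for `nil`. -/
def Data.hd : Data → Data
  | nil => nil
  | cons l _ => l

/-- Second component; `nil` for `nil`. -/
def Data.tl : Data → Data
  | nil => nil
  | cons _ r => r

/-- Values of the variables. -/
abbrev Store := ℕ → Data

/-- The store with input `d` in variable `0`, the other variables being `nil`. -/
def Store.init (d : Data) : Store := fun x => if x = 0 then d else .nil

/-- Assignment of `d` to the variable `x`. -/
def Store.set (s : Store) (x : ℕ) (d : Data) : Store := fun y => if y = x then d else s y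

/-- Expressions. -/
inductive Expr where
  | nil : Expr
  | var (x : ℕ) : Expr
  | cons (a b : Expr) : Expr
  | hd (a : Expr) : Expr
  | tl (a : Expr) : Expr

namespace Expr

/-- Value of an expression. -/
def eval (s : Store) : Expr → Data
  | nil => .nil
  | var x => s x
  | cons a b => .cons (a.eval s) (b.eval s)
  | hd a => (a.eval s).hd
  | tl a => (a.eval s).tl

/-- Time to evaluate an expression: the number of its operations. -/
def cost : Expr → ℕ
  | nil => 1
  | var _ => 1
  | cons a b => a.cost + b.cost + 1
  | hd a => a.cost + 1
  | tl a => a.cost + 1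

end Expr

/-- Programs. `nil` is false and every other value is true. -/
inductive Prog where
  /-- `x := e` -/
  | assign (x : ℕ) (e : Expr) : Prog
  /-- `p; q` -/
  | seq (p q : Prog) : Prog
  /-- `if e then p else q` -/
  | cond (e : Expr) (p q : Prog) : Prog
  /-- `while e do p` -/
  | loop (e : Expr) (p : Prog) : Prog
  /-- `x := p(e)`: execution of `p` as a subroutine with its own variables, with input and output
  in its variable `0` -/
  | call (x : ℕ) (p : Prog) (e : Expr) : Prog

/-- `Exec p s t s'`: started in store `s`, the program `p` halts after `t` time units in store
`s'`. -/
inductive Exec : Prog → Store → ℕ → Store → Prop where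
  | assign (x : ℕ) (e : Expr) (s : Store) :
      Exec (.assign x e) s (e.cost + 1) (s.set x (e.eval s))
  | seq {p q : Prog} {s s' s'' : Store} {t u : ℕ} (hp : Exec p s t s') (hq : Exec q s' u s'') :
      Exec (.seq p q) s (t + u + 1) s''
  | cond_true {e : Expr} {p q : Prog} {s s' : Store} {t : ℕ} (he : e.eval s ≠ .nil)
      (hp : Exec p s t s') : Exec (.cond e p q) s (e.cost + t + 1) s'
  | cond_false {e : Expr} {p q : Prog} {s s' : Store} {t : ℕ} (he : e.eval s = .nil)
      (hq : Exec q s t s') : Exec (.cond e p q) s (e.cost + t + 1) s'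
  | loop_done {e : Expr} {p : Prog} {s : Store} (he : e.eval s = .nil) :
      Exec (.loop e p) s (e.cost + 1) s
  | loop_step {e : Expr} {p : Prog} {s s' s'' : Store} {t u : ℕ} (he : e.eval s ≠ .nil)
      (hp : Exec p s t s') (hl : Exec (.loop e p) s' u s'') :
      Exec (.loop e p) s (e.cost + t + u + 1) s''
  | call {x : ℕ} {p : Prog} {e : Expr} {s s' : Store} {t : ℕ}
      (hp : Exec p (Store.init (e.eval s)) t s') :
      Exec (.call x p e) s (e.cost + t + 1) (s.set x (s' 0))

/-- Programs are deterministic: the final store and the running time are determined by the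
program and the initial store. -/
theorem Exec.deterministic {p : Prog} {s s₁ s₂ : Store} {t₁ t₂ : ℕ} (h₁ : Exec p s t₁ s₁)
    (h₂ : Exec p s t₂ s₂) : t₁ = t₂ ∧ s₁ = s₂ := by
  induction h₁ generalizing t₂ s₂ with
  | assign => cases h₂; exact ⟨rfl, rfl⟩
  | seq _ _ ih₁ ih₂ =>
    cases h₂ with
    | seq a b =>
      obtain ⟨rfl, rfl⟩ := ih₁ a
      obtain ⟨rfl, rfl⟩ := ih₂ b
      exact ⟨rfl, rfl⟩
  | cond_true he _ ih =>
    cases h₂ with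
    | cond_true _ a => obtain ⟨rfl, rfl⟩ := ih a; exact ⟨rfl, rfl⟩
    | cond_false he' _ => exact absurd he' he
  | cond_false he _ ih =>
    cases h₂ with
    | cond_true he' _ => exact absurd he he'
    | cond_false _ a => obtain ⟨rfl, rfl⟩ := ih a; exact ⟨rfl, rfl⟩
  | loop_done he =>
    cases h₂ with
    | loop_done _ => exact ⟨rfl, rfl⟩
    | loop_step he' _ _ => exact absurd he he'
  | loop_step he _ _ ih₁ ih₂ =>
    cases h₂ with
    | loop_done he' => exact absurd he' he
    | loop_step _ a b =>
      obtain ⟨rfl, rfl⟩ := ih₁ a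
      obtain ⟨rfl, rfl⟩ := ih₂ b
      exact ⟨rfl, rfl⟩
  | call _ ih =>
    cases h₂ with
    | call a => obtain ⟨rfl, rfl⟩ := ih a; exact ⟨rfl, rfl⟩

/-- On the given input, the program halts with the given output within `T` time units. -/
def Prog.ComputesWithin (p : Prog) (input output : Data) (T : ℕ) : Prop :=
  ∃ t s, Exec p (Store.init input) t s ∧ s 0 = output ∧ t ≤ T

/-! ## Encoding of finite objects as trees -/

/-- Truth values. -/
def encBool : Bool → Data
  | false => .nil
  | true => .cons .nil .nil

/-- Lists. -/
def encList : List Data → Data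
  | [] => .nil
  | d :: l => .cons d (encList l)

/-- Numbers in unary (used for sizes and indices). -/
def encUnary (n : ℕ) : Data := encList (List.replicate n .nil)

/-- Numbers in binary, least significant digit first. -/
def encBinary (n : ℕ) : Data := encList (n.bits.map encBool)

/-- Nonnegative rational numbers: numerator and denominator in binary. -/
def encRat (r : ℚ≥0) : Data := .cons (encBinary r.num) (encBinary r.den)

/-- Finite tables. -/
def encTable {n : ℕ} (f : Fin n → Data) : Data := encList (List.ofFn f)

open Classical in
/-- Propositions, as truth values. -/
noncomputable def encProp (P : Prop) : Data := encBool (decide P)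

end WhileLang

/-! # The decision problem -/

namespace ConcurrentGame

open WhileLang
open scoped NNReal ENNReal

/-- An input: an arena with `nS` states, `nE` actions of Eve and `nA` actions of Adam and with
rational transition probabilities `weight`, an automaton with `nQ` states, a set `K` of initial
states and a set `F` of final states. -/
structure Instance where
  nS : ℕ
  nE : ℕ
  nA : ℕ
  nQ : ℕ
  nE_pos : 0 < nE
  nA_pos : 0 < nA
  arena : Arena (Fin nS) (Fin nE) (Fin nA)
  weight : Fin nS → Fin nE → Fin nA → Fin nS → ℚ≥0
  arena_δ : ∀ s σE σA s', arena.δ s σE σA s' = ((weight s σE σA s' : ℝ≥0) : ℝ≥0∞)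
  T : ActionAutomaton arena (Fin nQ)
  K : Set (Fin nS)
  F : Set (Fin nS)

namespace Instance

/-- The encoding of an input. The transition function of the automaton is tabulated with an
observation given by any state of the class. -/
noncomputable def encode (I : Instance) : Data :=
  encList
    [encUnary I.nS, encUnary I.nE, encUnary I.nA, encUnary I.nQ,
      encTable fun s => encTable fun σE => encTable fun σA => encTable fun s' =>
        encRat (I.weight s σE σA s'),
      encTable fun s => encTable fun t => encProp (I.arena.simE s t),
      encTable fun s => encTable fun t => encProp (I.arena.simA s t),
      encUnary I.T.q₀,
      encUnary I.T.qs,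
      encTable fun q => encTable fun σ => encTable fun s =>
        encUnary (I.T.δ q σ (Quotient.mk I.arena.simE s)),
      encTable fun q => encTable fun σ => encProp (σ ∈ I.T.act q),
      encTable fun s => encProp (s ∈ I.K),
      encTable fun s => encProp (s ∈ I.F)]

/-- `φ` is a `T`-compatible strategy of Eve that is positively winning in `(𝒜, K, F)`. -/
def WinningStrategy (I : Instance) (φ : I.arena.StrategyE) : Prop :=
  I.T.Compatible I.K φ ∧ I.arena.PositivelyWinning I.K I.F φ

/-- The encoding of a finite-memory strategy of Eve, with an observation given by any state of the
class. -/
def encodeMemory (I : Instance) (M : FiniteMemory I.arena.ObsE (Fin I.nE)) : Data :=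
  encList
    [encUnary M.size,
      encUnary M.init,
      encTable fun m => encTable fun s => encUnary (M.next m (Quotient.mk I.arena.simE s)),
      encTable fun m => encUnary (M.out m)]

/-- The value of the polynomial `p` at `2 ^ |S|`, `|Q|`, `|Σ_E|`, `|Σ_A|`. -/
noncomputable def timeBound (I : Instance) (p : MvPolynomial (Fin 4) ℕ) : ℕ :=
  MvPolynomial.eval ![2 ^ I.nS, I.nQ, I.nE, I.nA] p

/-- The value of the polynomial `p` at `2 ^ |S|`, `|Q|`. -/
noncomputable def memoryBound (I : Instance) (p : MvPolynomial (Fin 2) ℕ) : ℕ :=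
  MvPolynomial.eval ![2 ^ I.nS, I.nQ] p

end Instance

end ConcurrentGame

/-!
Since Adam observes the state, Eve's strategy `φ` is positively winning iff from every initial
state the plays that respect `φ` form a tree in which Adam cannot avoid `F` forever: in each state
and for each of his actions some successor of positive probability makes progress
(`Arena.Forces`, `Arena.positivelyWinning_iff`). By the chain rule for cylinders, the existence of
such finite plays is what the probability of reaching `F` being positive means; conversely, if
progress cannot be forced, Adam has a strategy that almost surely keeps it so, and hence avoids `F`.

All states to which Eve is committed after the same observations share her action. It is therefore
enough to remember the state `q` of the automaton and the set `B` of these states, and to solve a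
reachability game on the pairs `(q, B)`. There Eve chooses an admissible action and a set `C` of
states that meets the support of the transition from every state of `B` and every action of Adam;
an observation `x` leads to `(q', (C \ F) ∩ x)`. The game is won when no obligation is left:
compatibility with the automaton is then no further restriction, because an admissible action never
leads to its sink. A winning strategy of Eve wins this game (`Instance.mem_won_of_forces`), and
a positional strategy for it, computed by an attractor construction, is a finite-memory strategy of
Eve that wins the original game (`Instance.winningStrategy_memory`).

There are `|Q| * 2 ^ |S|` positions and `|Σ_E| * 2 ^ |S|` moves, so the attractor construction is
polynomial. It is turned into a program by closure properties of `WhileLang.PolyComp`, the relation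
"computable from a context in polynomial time"; the basic one is `PolyComp.iter`, for loops over
lists of polynomial length. As trees are copied in constant time, and as only the vanishing of the
transition probabilities matters, the size of the data does not enter into the bounds.
-/

/-! ### Polynomial-time computable families of trees -/

namespace WhileLang

section PolyTime

variable {ι κ σ : Type}

/-- The values of `n` are bounded by a polynomial in the parameters `N`. -/
def PolyBound (N : ι → σ → ℕ) (n : ι → ℕ) : Prop :=
  ∃ q : MvPolynomial σ ℕ, ∀ i, n i ≤ MvPolynomial.eval (N i) q

/-- One program computes `b i` from `Γ i`, for all indices `i`, in time polynomial in the
parameters `N i`. The tree `Γ i` plays the role of a context: it holds the input and the values of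
the variables that are bound by the enclosing loops. The size of the trees does not matter, because
trees are copied in constant time. -/
def PolyComp (N : ι → σ → ℕ) (Γ b : ι → Data) : Prop :=
  ∃ (P : Prog) (p : MvPolynomial σ ℕ), ∀ i,
    P.ComputesWithin (Γ i) (b i) (MvPolynomial.eval (N i) p)

/-- One program decides `P i` from `Γ i`, for all indices `i`, in time polynomial in the
parameters `N i`. -/
def PolyDec (N : ι → σ → ℕ) (Γ : ι → Data) (P : ι → Prop) : Prop :=
  PolyComp N Γ fun i => encProp (P i)

/-- The lists `l i`, with elements encoded by `e i`, are computable in polynomial time and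
polynomially long. -/
structure PolyEnum (N : ι → σ → ℕ) (Γ : ι → Data) {β : ι → Type} (l : ∀ i, List (β i))
    (e : ∀ i, β i → Data) : Prop where
  list : PolyComp N Γ fun i => encList ((l i).map (e i))
  bound : PolyBound N fun i => (l i).length

theorem encProp_of {P : Prop} (h : P) : encProp P = .cons .nil .nil := by
  simp [encProp, h, encBool]

theorem encProp_of_not {P : Prop} (h : ¬ P) : encProp P = .nil := by
  simp [encProp, h, encBool]

theorem encProp_ne_nil {P : Prop} : encProp P ≠ .nil ↔ P := by
  refine ⟨fun h => not_not.1 fun h' => h (encProp_of_not h'), fun h => ?_⟩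
  rw [encProp_of h]
  simp

theorem encProp_bool (b : Bool) : encProp (b = true) = encBool b := by
  cases b <;> simp [encProp]

variable {N : ι → σ → ℕ} {Γ : ι → Data}

namespace PolyBound

theorem of_le {m n : ι → ℕ} (h : PolyBound N n) (hmn : ∀ i, m i ≤ n i) : PolyBound N m :=
  ⟨h.choose, fun i => (hmn i).trans (h.choose_spec i)⟩

theorem mul {m n : ι → ℕ} (hm : PolyBound N m) (hn : PolyBound N n) :
    PolyBound N fun i => m i * n i := by
  obtain ⟨p, hp⟩ := hm
  obtain ⟨q, hq⟩ := hn
  exact ⟨p * q, fun i => by rw [map_mul]; exact Nat.mul_le_mul (hp i) (hq i)⟩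

theorem reindex {n : ι → ℕ} (h : PolyBound N n) (g : κ → ι) :
    PolyBound (fun k => N (g k)) fun k => n (g k) :=
  ⟨h.choose, fun k => h.choose_spec (g k)⟩

end PolyBound

namespace PolyComp

variable {b c : ι → Data}

theorem congr (h : PolyComp N Γ b) (hbc : ∀ i, b i = c i) : PolyComp N Γ c := by
  rwa [← funext hbc]

theorem reindex (h : PolyComp N Γ b) (g : κ → ι) :
    PolyComp (fun k => N (g k)) (fun k => Γ (g k)) fun k => b (g k) := by
  obtain ⟨P, p, hP⟩ := h
  exact ⟨P, p, fun k => hP (g k)⟩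

theorem expr (e : Expr) : PolyComp N Γ fun i => e.eval (Store.init (Γ i)) :=
  ⟨.assign 0 e, MvPolynomial.C (e.cost + 1), fun i =>
    ⟨_, _, .assign 0 e _, by simp [Store.set], by simp⟩⟩

/-- Subroutine calls have private variables, so programs compose without any interference. -/
theorem comp (hb : PolyComp N Γ b) (hc : PolyComp N b c) : PolyComp N Γ c := by
  obtain ⟨P, p, hP⟩ := hb
  obtain ⟨Q, q, hQ⟩ := hc
  refine ⟨.seq (.call 0 P (.var 0)) (.call 0 Q (.var 0)), p + q + MvPolynomial.C 5, fun i => ?_⟩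
  obtain ⟨t, s, h₁, h₂, h₃⟩ := hP i
  obtain ⟨t', s', h₁', h₂', h₃'⟩ := hQ i
  refine ⟨_, _, .seq (.call (t := t) (s' := s) h₁) (.call (t := t') (s' := s') ?_), ?_, ?_⟩
  · simpa [Expr.eval, Store.set, h₂] using h₁'
  · simp [Store.set, h₂']
  · simp [Expr.cost]; omega

theorem id : PolyComp N Γ Γ := (expr (N := N) (.var 0)).congr fun i => by
  simp [Expr.eval, Store.init]

theorem nil : PolyComp N Γ fun _ => .nil := expr .nil

theorem hd (hb : PolyComp N Γ b) : PolyComp N Γ fun i => (b i).hd :=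
  hb.comp (expr (.hd (.var 0)))

theorem tl (hb : PolyComp N Γ b) : PolyComp N Γ fun i => (b i).tl :=
  hb.comp (expr (.tl (.var 0)))

theorem cons (hb : PolyComp N Γ b) (hc : PolyComp N Γ c) :
    PolyComp N Γ fun i => .cons (b i) (c i) := by
  obtain ⟨P, p, hP⟩ := hb
  obtain ⟨Q, q, hQ⟩ := hc
  refine ⟨.seq (.call 1 P (.var 0)) (.seq (.call 2 Q (.var 0))
    (.assign 0 (.cons (.var 1) (.var 2)))), p + q + MvPolynomial.C 10, fun i => ?_⟩
  obtain ⟨t, s, h₁, h₂, h₃⟩ := hP i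
  obtain ⟨t', s', h₁', h₂', h₃'⟩ := hQ i
  refine ⟨_, _, .seq (.call (t := t) (s' := s) h₁)
    (.seq (.call (t := t') (s' := s') ?_) (.assign _ _ _)), ?_, ?_⟩
  · simpa [Expr.eval, Store.set, Store.init] using h₁'
  · simp [Store.set, Expr.eval, h₂, h₂']
  · simp [Expr.cost]; omega

open Classical in
theorem ite {D : ι → Prop} (hD : PolyDec N Γ D) (hb : PolyComp N Γ b) (hc : PolyComp N Γ c) :
    PolyComp N Γ fun i => if D i then b i else c i := by
  obtain ⟨P, p, hP⟩ := hD
  obtain ⟨Q, q, hQ⟩ := hb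
  obtain ⟨R, r, hR⟩ := hc
  refine ⟨.seq (.call 1 P (.var 0)) (.cond (.var 1) (.call 0 Q (.var 0)) (.call 0 R (.var 0))),
    p + q + r + MvPolynomial.C 7, fun i => ?_⟩
  obtain ⟨t, s, h₁, h₂, h₃⟩ := hP i
  obtain ⟨u, s', k₁, k₂, k₃⟩ := hQ i
  obtain ⟨v, s'', m₁, m₂, m₃⟩ := hR i
  beta_reduce at h₂ ⊢
  split_ifs with h
  · rw [encProp_of h] at h₂
    refine ⟨_, _, .seq (.call (t := t) (s' := s) h₁)
      (.cond_true ?_ (.call (t := u) (s' := s') ?_)), ?_, ?_⟩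
    · simp [Expr.eval, Store.set, h₂]
    · simpa [Expr.eval, Store.set, Store.init] using k₁
    · simp [Store.set, k₂]
    · simp [Expr.cost]; omega
  · rw [encProp_of_not h] at h₂
    refine ⟨_, _, .seq (.call (t := t) (s' := s) h₁)
      (.cond_false ?_ (.call (t := v) (s' := s'') ?_)), ?_, ?_⟩
    · simp [Expr.eval, Store.set, h₂]
    · simpa [Expr.eval, Store.set, Store.init] using m₁
    · simp [Store.set, m₂]
    · simp [Expr.cost]; omega

end PolyComp

/-- The loop behind `PolyComp.iter`: variable `0` holds the context, variable `1` the accumulator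
and variable `2` the rest of the list. A round costs at most `T + 13`, the constant accounting for
the call, for popping the list and for the test. -/
theorem exec_loop {S : Prog} {g : Data} {l : List Data} {acc : ℕ → Data} {T : ℕ}
    (hS : ∀ k (hk : k < l.length),
      S.ComputesWithin (.cons g (.cons (acc k) l[k])) (acc (k + 1)) T) (j : ℕ) :
    ∀ (k : ℕ) (s : Store), k + j = l.length → s 0 = g → s 1 = acc k → s 2 = encList (l.drop k) →
      ∃ t s', Exec (.loop (.var 2) (.seq
          (.call 1 S (.cons (.var 0) (.cons (.var 1) (.hd (.var 2)))))
          (.assign 2 (.tl (.var 2))))) s t s' ∧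
        s' 1 = acc l.length ∧ t ≤ j * (T + 13) + 2 := by
  induction j with
  | zero =>
    intro k s hk h₀ h₁ h₂
    obtain rfl : k = l.length := by omega
    refine ⟨_, s, .loop_done ?_, h₁, by simp [Expr.cost]⟩
    simp [Expr.eval, h₂, encList]
  | succ j ih =>
    intro k s hk h₀ h₁ h₂
    have hkl : k < l.length := by omega
    rw [List.drop_eq_getElem_cons hkl, encList] at h₂
    obtain ⟨t, s', e₁, e₂, e₃⟩ := hS k hkl
    let s₁ := s.set 1 (s' 0)
    let s₂ := s₁.set 2 (encList (l.drop (k + 1)))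
    obtain ⟨u, s₃, f₁, f₂, f₃⟩ := ih (k + 1) s₂ (by omega) (by simp [s₂, s₁, Store.set, h₀])
      (by simp [s₂, s₁, Store.set, e₂]) (by simp [s₂, Store.set])
    have hb : Exec (.seq (.call 1 S (.cons (.var 0) (.cons (.var 1) (.hd (.var 2)))))
        (.assign 2 (.tl (.var 2)))) s (6 + t + 1 + 3 + 1) s₂ := by
      have h := Exec.seq (Exec.call (x := 1) (p := S)
        (e := .cons (.var 0) (.cons (.var 1) (.hd (.var 2)))) (s := s) (s' := s') (t := t)
        (by simpa [Expr.eval, h₀, h₁, h₂, Data.hd] using e₁))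
        (Exec.assign 2 (.tl (.var 2)) _)
      have e : (s.set 1 (s' 0)).set 2 ((Expr.tl (.var 2)).eval (s.set 1 (s' 0))) = s₂ := by
        simp [s₂, s₁, Expr.eval, Store.set, h₂, Data.tl]
      rw [e] at h
      exact h
    refine ⟨_, s₃, .loop_step ?_ hb f₁, f₂, ?_⟩
    · simp [Expr.eval, h₂]
    · simp only [Expr.cost, Nat.succ_mul]
      omega

/-- A loop over a list: the accumulator `acc i k` is the value before the element number `k`. The
body has to be correct only for these values, in the context extended by the accumulator and the
current element. -/
theorem PolyComp.iter {β : ι → Type} {l : ∀ i, List (β i)} {e : ∀ i, β i → Data}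
    (hl : PolyEnum N Γ l e) (acc : ∀ _ : ι, ℕ → Data) (h₀ : PolyComp N Γ fun i => acc i 0)
    (hs : PolyComp (fun p : Σ i, Fin (l i).length => N p.1)
      (fun p => .cons (Γ p.1) (.cons (acc p.1 p.2) (e p.1 (l p.1)[p.2])))
      fun p => acc p.1 (p.2 + 1)) :
    PolyComp N Γ fun i => acc i (l i).length := by
  obtain ⟨⟨P, p, hP⟩, q, hq⟩ := hl
  obtain ⟨Q, r, hQ⟩ := h₀
  obtain ⟨S, u, hS⟩ := hs
  refine ⟨.seq (.call 1 Q (.var 0)) (.seq (.call 2 P (.var 0)) (.seq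
    (.loop (.var 2) (.seq (.call 1 S (.cons (.var 0) (.cons (.var 1) (.hd (.var 2)))))
          (.assign 2 (.tl (.var 2))))) (.assign 0 (.var 1)))),
    p + r + q * (u + MvPolynomial.C 13) + MvPolynomial.C 11, fun i => ?_⟩
  obtain ⟨t, s, h₁, h₂, h₃⟩ := hQ i
  obtain ⟨t', s', h₁', h₂', h₃'⟩ := hP i
  beta_reduce at h₂ h₂' hq
  have hS' : ∀ k (hk : k < ((l i).map (e i)).length),
      S.ComputesWithin (.cons (Γ i) (.cons (acc i k) ((l i).map (e i))[k])) (acc i (k + 1))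
        (MvPolynomial.eval (N i) u) := by
    intro k hk
    rw [List.length_map] at hk
    simpa using hS ⟨i, ⟨k, hk⟩⟩
  obtain ⟨v, s'', e₁, e₂, e₃⟩ := exec_loop hS' (l i).length 0
    (((Store.init (Γ i)).set 1 (acc i 0)).set 2 (encList ((l i).map (e i)))) (by simp)
    (by simp [Store.set, Store.init]) (by simp [Store.set]) (by simp [Store.set])
  rw [List.length_map] at e₂
  rw [← h₂, ← h₂'] at e₁
  refine ⟨_, _, .seq (.call (t := t) (s' := s) h₁) (.seq (.call (t := t') (s' := s') ?_)
    (.seq e₁ (.assign _ _ _))), ?_, ?_⟩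
  · simpa [Expr.eval, Store.set, Store.init] using h₁'
  · simp [Store.set, Expr.eval, e₂]
  · simp only [Expr.cost, map_add, map_mul, MvPolynomial.eval_C]
    have := Nat.mul_le_mul_right (MvPolynomial.eval (N i) u + 13) (hq i)
    omega

/-- Loops whose body is correct for every value of the accumulator. -/
theorem PolyComp.foldl {β γ : ι → Type} {l : ∀ i, List (β i)} {e : ∀ i, β i → Data}
    (hl : PolyEnum N Γ l e) (eγ : ∀ i, γ i → Data) (f : ∀ i, γ i → β i → γ i) {z : ∀ i, γ i}
    (hz : PolyComp N Γ fun i => eγ i (z i))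
    (hs : PolyComp (fun p : Σ i, γ i × β i => N p.1)
      (fun p => .cons (Γ p.1) (.cons (eγ p.1 p.2.1) (e p.1 p.2.2)))
      fun p => eγ p.1 (f p.1 p.2.1 p.2.2)) :
    PolyComp N Γ fun i => eγ i ((l i).foldl (f i) (z i)) := by
  have h := PolyComp.iter hl (fun i k => eγ i (((l i).take k).foldl (f i) (z i)))
    (hz.congr fun i => by simp)
    ((hs.reindex fun p : Σ i, Fin (l i).length =>
      ⟨p.1, ((l p.1).take p.2).foldl (f p.1) (z p.1), (l p.1)[p.2]⟩).congr fun p => by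
        simp only [Fin.getElem_fin]
        rw [List.take_succ_eq_append_getElem p.2.2, List.foldl_append]
        rfl)
  exact h.congr fun i => by simp

/-! ### Contexts, decisions and loops -/

section Context

variable {b x y : ι → Data}

/-- Computations from the outer context remain valid in a loop body. -/
theorem PolyComp.weaken (h : PolyComp N Γ b) {β : ι → Type} {r : (Σ i, β i) → Data} :
    PolyComp (fun p : Σ i, β i => N p.1) (fun p => .cons (Γ p.1) (r p)) fun p => b p.1 :=
  PolyComp.id.hd.comp (h.reindex Sigma.fst)

/-- The innermost loop variable. -/
theorem PolyComp.last : PolyComp N (fun i => .cons (y i) (x i)) x := PolyComp.id.tl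

theorem PolyComp.nilPair : PolyComp N Γ fun _ => .cons .nil .nil := .cons .nil .nil

end Context

namespace PolyDec

variable {P Q : ι → Prop}

theorem congr (h : PolyDec N Γ P) (hPQ : ∀ i, P i ↔ Q i) : PolyDec N Γ Q :=
  PolyComp.congr h fun i => by rw [hPQ i]

theorem isNil {b : ι → Data} (h : PolyComp N Γ b) : PolyDec N Γ fun i => b i = .nil := by
  obtain ⟨P, p, hP⟩ := h
  refine ⟨.seq (.call 1 P (.var 0)) (.cond (.var 1) (.assign 0 .nil)
    (.assign 0 (.cons .nil .nil))), p + MvPolynomial.C 10, fun i => ?_⟩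
  obtain ⟨t, s, h₁, h₂, h₃⟩ := hP i
  by_cases h : b i = .nil
  · refine ⟨_, _, .seq (.call (t := t) (s' := s) h₁) (.cond_false ?_ (.assign _ _ _)), ?_, ?_⟩
    · simp [Expr.eval, Store.set, h₂, h]
    · simp [Store.set, Expr.eval, encProp_of h]
    · simp [Expr.cost]; omega
  · refine ⟨_, _, .seq (.call (t := t) (s' := s) h₁) (.cond_true ?_ (.assign _ _ _)), ?_, ?_⟩
    · simp [Expr.eval, Store.set, h₂, h]
    · simp [Store.set, Expr.eval, encProp_of_not h]
    · simp [Expr.cost]; omega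

theorem not (h : PolyDec N Γ P) : PolyDec N Γ fun i => ¬ P i :=
  (isNil h).congr fun _ => ⟨fun h hP => encProp_ne_nil.2 hP h, encProp_of_not⟩

theorem and (hP : PolyDec N Γ P) (hQ : PolyDec N Γ Q) : PolyDec N Γ fun i => P i ∧ Q i :=
  (PolyComp.ite hP hQ .nil).congr fun i => by
    split_ifs with h
    · simp [h]
    · exact (encProp_of_not fun h' => h h'.1).symm

theorem imp (hP : PolyDec N Γ P) (hQ : PolyDec N Γ Q) : PolyDec N Γ fun i => P i → Q i :=
  (hP.and hQ.not).not.congr fun i => by tauto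

theorem iff (hP : PolyDec N Γ P) (hQ : PolyDec N Γ Q) : PolyDec N Γ fun i => P i ↔ Q i :=
  ((hP.imp hQ).and (hQ.imp hP)).congr fun i => by tauto

theorem bool {b : ι → Bool} (h : PolyDec N Γ fun i => b i = true) :
    PolyComp N Γ fun i => encBool (b i) :=
  PolyComp.congr h fun i => encProp_bool (b i)

theorem of_bool {b : ι → Bool} (h : PolyComp N Γ fun i => encBool (b i)) :
    PolyDec N Γ fun i => b i = true :=
  PolyComp.congr h fun i => (encProp_bool (b i)).symm

end PolyDec

section Loops

variable {β : ι → Type} {l : ∀ i, List (β i)} {e : ∀ i, β i → Data}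

theorem PolyDec.ball (hl : PolyEnum N Γ l e) {P : ∀ i, β i → Prop}
    (hP : PolyDec (fun p : Σ i, β i => N p.1) (fun p => .cons (Γ p.1) (e p.1 p.2))
      fun p => P p.1 p.2) : PolyDec N Γ fun i => ∀ b ∈ l i, P i b := by
  have h := PolyComp.foldl hl (γ := fun _ => Prop) (fun _ p => encProp p)
    (fun i p b => p ∧ P i b) (z := fun _ => True)
    (PolyComp.nilPair.congr fun i => (encProp_of trivial).symm)
    (PolyDec.and (PolyComp.id.tl.hd)
      ((PolyComp.cons PolyComp.id.hd PolyComp.id.tl.tl).comp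
        (hP.reindex fun p : Σ i, Prop × β i => ⟨p.1, p.2.2⟩)))
  refine PolyDec.congr h fun i => ?_
  have : ∀ (L : List (β i)) (p : Prop),
      L.foldl (fun p b => p ∧ P i b) p ↔ p ∧ ∀ b ∈ L, P i b := by
    intro L
    induction L with
    | nil => simp
    | cons b L ih => intro p; rw [List.foldl_cons, ih]; simp [and_assoc]
  rw [this]
  simp

theorem PolyDec.bex (hl : PolyEnum N Γ l e) {P : ∀ i, β i → Prop}
    (hP : PolyDec (fun p : Σ i, β i => N p.1) (fun p => .cons (Γ p.1) (e p.1 p.2))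
      fun p => P p.1 p.2) : PolyDec N Γ fun i => ∃ b ∈ l i, P i b :=
  (PolyDec.ball hl (P := fun i b => ¬ P i b) hP.not).not.congr fun i => by push Not; rfl

/-- Pushing the images of the elements of a list onto a stack reverses their order. -/
theorem PolyComp.revMapAppend (hl : PolyEnum N Γ l e) {g : ∀ i, β i → Data}
    (hg : PolyComp (fun p : Σ i, β i => N p.1) (fun p => .cons (Γ p.1) (e p.1 p.2))
      fun p => g p.1 p.2) {m : ι → List Data} (hm : PolyComp N Γ fun i => encList (m i)) :
    PolyComp N Γ fun i => encList (((l i).map (g i)).reverse ++ m i) := by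
  have h := PolyComp.foldl hl (γ := fun _ => List Data) (fun _ L => encList L)
    (fun i L b => g i b :: L) hm
    (PolyComp.cons ((PolyComp.cons PolyComp.id.hd PolyComp.id.tl.tl).comp
        (hg.reindex fun p : Σ i, List Data × β i => ⟨p.1, p.2.2⟩)) (PolyComp.id.tl.hd))
  refine h.congr fun i => ?_
  have : ∀ (L : List (β i)) (m : List Data),
      L.foldl (fun L b => g i b :: L) m = (L.map (g i)).reverse ++ m := by
    intro L
    induction L with
    | nil => simp
    | cons b L ih => intro m; rw [List.foldl_cons, ih]; simp
  rw [this]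

/-- A list of trees as an enumeration. -/
theorem PolyEnum.of_list {m : ι → List Data} (hm : PolyComp N Γ fun i => encList (m i))
    (hb : PolyBound N fun i => (m i).length) : PolyEnum N Γ m fun _ d => d :=
  ⟨hm.congr fun i => by simp, hb⟩

theorem PolyComp.mapAppend (hl : PolyEnum N Γ l e) {g : ∀ i, β i → Data}
    (hg : PolyComp (fun p : Σ i, β i => N p.1) (fun p => .cons (Γ p.1) (e p.1 p.2))
      fun p => g p.1 p.2) {m : ι → List Data} (hm : PolyComp N Γ fun i => encList (m i)) :
    PolyComp N Γ fun i => encList ((l i).map (g i) ++ m i) := by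
  have h := PolyComp.revMapAppend hl hg (m := fun _ => []) .nil
  have h' := PolyComp.revMapAppend (PolyEnum.of_list h (hl.bound.of_le fun i => by simp))
    (g := fun _ d => d) .last hm
  exact h'.congr fun i => by simp [Function.comp_def]

theorem PolyComp.map (hl : PolyEnum N Γ l e) {g : ∀ i, β i → Data}
    (hg : PolyComp (fun p : Σ i, β i => N p.1) (fun p => .cons (Γ p.1) (e p.1 p.2))
      fun p => g p.1 p.2) : PolyComp N Γ fun i => encList ((l i).map (g i)) :=
  (PolyComp.mapAppend hl hg (m := fun _ => []) .nil).congr fun i => by simp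

theorem PolyEnum.map (hl : PolyEnum N Γ l e) {g : ∀ i, β i → Data}
    (hg : PolyComp (fun p : Σ i, β i => N p.1) (fun p => .cons (Γ p.1) (e p.1 p.2))
      fun p => g p.1 p.2) : PolyEnum N Γ l g :=
  ⟨PolyComp.map hl hg, hl.bound⟩

/-- Optional values. -/
def encOption {α : Type} (e : α → Data) : Option α → Data
  | none => .nil
  | some a => .cons (e a) .nil

theorem encOption_eq_nil {α : Type} {e : α → Data} {o : Option α} :
    encOption e o = .nil ↔ o = none := by
  cases o <;> simp [encOption]

theorem PolyComp.find? (hl : PolyEnum N Γ l e) {P : ∀ i, β i → Bool}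
    (hP : PolyDec (fun p : Σ i, β i => N p.1) (fun p => .cons (Γ p.1) (e p.1 p.2))
      fun p => P p.1 p.2 = true) :
    PolyComp N Γ fun i => encOption (e i) ((l i).find? (P i)) := by
  have h := PolyComp.foldl hl (γ := fun i => Option (β i)) (fun i o => encOption (e i) o)
    (fun i o b => o.or (if P i b then some b else none)) (z := fun _ => none) .nil
    ((PolyComp.ite (PolyDec.isNil PolyComp.id.tl.hd)
      (PolyComp.ite ((PolyComp.cons PolyComp.id.hd PolyComp.id.tl.tl).comp
        (hP.reindex fun p : Σ i, Option (β i) × β i => ⟨p.1, p.2.2⟩))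
        (PolyComp.cons PolyComp.id.tl.tl .nil) .nil) PolyComp.id.tl.hd).congr ?_)
  · refine h.congr fun i => ?_
    have : ∀ (L : List (β i)) (o : Option (β i)),
        L.foldl (fun o b => o.or (if P i b then some b else none)) o = o.or (L.find? (P i)) := by
      intro L
      induction L with
      | nil => simp
      | cons b L ih =>
        intro o
        rw [List.foldl_cons, ih, Option.or_assoc, List.find?_cons]
        cases P i b <;> simp
    rw [this, Option.none_or]
  · rintro ⟨i, o, b⟩
    cases o with
    | none => cases hb : P i b <;> simp [Data.hd, Data.tl, encOption, hb]
    | some a => simp [Data.hd, Data.tl, encOption]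

theorem PolyEnum.weaken (hl : PolyEnum N Γ l e) {α : ι → Type} {r : (Σ i, α i) → Data} :
    PolyEnum (fun p : Σ i, α i => N p.1) (fun p => .cons (Γ p.1) (r p)) (fun p => l p.1)
      fun p => e p.1 :=
  ⟨hl.list.weaken, hl.bound.reindex _⟩

end Loops

/-! ### Numbers and tables as data -/

section Tables

variable {n : ι → ℕ}

theorem PolyEnum.unary (hn : PolyComp N Γ fun i => encUnary (n i)) (hb : PolyBound N n) :
    PolyEnum N Γ (fun i => List.replicate (n i) Data.nil) fun _ d => d :=
  .of_list hn (hb.of_le fun i => by simp)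

theorem PolyEnum.finRange (hn : PolyComp N Γ fun i => encUnary (n i)) (hb : PolyBound N n) :
    PolyEnum N Γ (fun i => List.finRange (n i)) fun _ j => encUnary j := by
  have h := PolyComp.foldl (PolyEnum.unary hn hb) (γ := fun _ => ℕ × List Data)
    -- the accumulator holds the next number and the reversed list of the previous ones
    (fun _ p => .cons (encUnary p.1) (encList p.2)) (fun i p _ => (p.1 + 1, encUnary p.1 :: p.2))
    (z := fun _ => (0, [])) (PolyComp.cons .nil .nil)
    (PolyComp.cons (.cons .nil PolyComp.id.tl.hd.hd)
      (.cons PolyComp.id.tl.hd.hd PolyComp.id.tl.hd.tl))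
  have key : ∀ k : ℕ, (List.replicate k Data.nil).foldl
      (fun (p : ℕ × List Data) _ => (p.1 + 1, encUnary p.1 :: p.2)) (0, []) =
        (k, ((List.range k).map encUnary).reverse) := by
    intro k
    induction k with
    | zero => rfl
    | succ k ih => rw [List.replicate_succ', List.foldl_append, ih, List.range_succ]; simp
  have h' : PolyComp N Γ fun i => encList ((List.range (n i)).map encUnary).reverse :=
    h.tl.congr fun i => by rw [key]; rfl
  refine ⟨(PolyComp.revMapAppend (PolyEnum.of_list h' (hb.of_le fun i => by simp))
    (g := fun _ d => d) .last (m := fun _ => []) .nil).congr fun i => ?_,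
    hb.of_le fun i => by simp⟩
  rw [List.map_id', List.reverse_reverse, List.append_nil, ← List.map_coe_finRange_eq_range,
    List.map_map]
  rfl

theorem PolyComp.drop {m : ι → List Data} (hm : PolyComp N Γ fun i => encList (m i))
    (hn : PolyComp N Γ fun i => encUnary (n i)) (hb : PolyBound N n) :
    PolyComp N Γ fun i => encList ((m i).drop (n i)) := by
  have h := PolyComp.foldl (PolyEnum.unary hn hb) (γ := fun _ => List Data)
    (fun _ L => encList L) (fun i L _ => L.tail) hm
    (PolyComp.id.tl.hd.tl.congr fun p => by
      obtain ⟨i, L, d⟩ := p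
      cases L <;> rfl)
  refine h.congr fun i => ?_
  have : ∀ (k : ℕ) (L : List Data),
      (List.replicate k Data.nil).foldl (fun L _ => L.tail) L = L.drop k := by
    intro k
    induction k with
    | zero => simp
    | succ k ih => intro L; rw [List.replicate_succ, List.foldl_cons, ih, List.drop_tail]
  rw [this]

/-- Table lookup. -/
theorem PolyComp.get {f : ∀ i, Fin (n i) → Data} {j : ∀ i, Fin (n i)}
    (hf : PolyComp N Γ fun i => encTable (f i)) (hj : PolyComp N Γ fun i => encUnary (j i))
    (hb : PolyBound N n) : PolyComp N Γ fun i => f i (j i) :=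
  (PolyComp.drop hf hj (hb.of_le fun i => (j i).2.le)).hd.congr fun i => by
    rw [List.drop_eq_getElem_cons (by simp)]
    simp [encList, Data.hd]

theorem PolyDec.fin_eq {j k : ∀ i, Fin (n i)} (hj : PolyComp N Γ fun i => encUnary (j i))
    (hk : PolyComp N Γ fun i => encUnary (k i)) (hb : PolyBound N n) :
    PolyDec N Γ fun i => j i = k i := by
  have le : ∀ {j k : ∀ i, Fin (n i)}, PolyComp N Γ (fun i => encUnary (j i)) →
      PolyComp N Γ (fun i => encUnary (k i)) → PolyDec N Γ fun i => j i ≤ k i := by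
    intro j k hj hk
    -- in unary, `j ≤ k` iff dropping `k` digits of `j` leaves nothing
    refine (PolyDec.isNil (PolyComp.drop hj hk (hb.of_le fun i => (k i).2.le))).congr fun i => ?_
    rw [List.drop_replicate]
    rcases h : (j i : ℕ) - (k i : ℕ) with _ | d
    · simp only [List.replicate_zero, encList, true_iff, Fin.le_def]; omega
    · simp only [List.replicate_succ, encList, reduceCtorEq, false_iff, Fin.le_def]; omega
  exact ((le hj hk).and (le hk hj)).congr fun i => le_antisymm_iff.symm

theorem encTable_eq_map {m : ℕ} (f : Fin m → Data) :
    encTable f = encList ((List.finRange m).map f) := by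
  rw [encTable, List.ofFn_eq_map]

theorem PolyComp.table (hn : PolyComp N Γ fun i => encUnary (n i)) (hb : PolyBound N n)
    {g : ∀ i, Fin (n i) → Data}
    (hg : PolyComp (fun p : Σ i, Fin (n i) => N p.1) (fun p => .cons (Γ p.1) (encUnary p.2))
      fun p => g p.1 p.2) : PolyComp N Γ fun i => encTable (g i) :=
  (PolyComp.map (PolyEnum.finRange hn hb) hg).congr fun _ => (encTable_eq_map _).symm

theorem PolyDec.forall_fin (hn : PolyComp N Γ fun i => encUnary (n i)) (hb : PolyBound N n)
    {P : ∀ i, Fin (n i) → Prop}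
    (hP : PolyDec (fun p : Σ i, Fin (n i) => N p.1) (fun p => .cons (Γ p.1) (encUnary p.2))
      fun p => P p.1 p.2) : PolyDec N Γ fun i => ∀ j, P i j :=
  (PolyDec.ball (PolyEnum.finRange hn hb) hP).congr fun i => by simp

theorem PolyDec.exists_fin (hn : PolyComp N Γ fun i => encUnary (n i)) (hb : PolyBound N n)
    {P : ∀ i, Fin (n i) → Prop}
    (hP : PolyDec (fun p : Σ i, Fin (n i) => N p.1) (fun p => .cons (Γ p.1) (encUnary p.2))
      fun p => P p.1 p.2) : PolyDec N Γ fun i => ∃ j, P i j :=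
  (PolyDec.bex (PolyEnum.finRange hn hb) hP).congr fun i => by simp

theorem PolyComp.length {β : ι → Type} {l : ∀ i, List (β i)} {e : ∀ i, β i → Data}
    (hl : PolyEnum N Γ l e) : PolyComp N Γ fun i => encUnary (l i).length :=
  (PolyComp.map hl (g := fun _ _ => .nil) .nil).congr fun _ => by
    rw [List.map_const']; rfl

end Tables

end PolyTime

end WhileLang

/-! ### Positive winning as a finitary condition on the tree of plays -/

namespace ConcurrentGame

open MeasureTheory ProbabilityTheory

namespace Arena

section Cylinders

variable {S E A : Type} (𝒜 : Arena S E A)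

/-- The sequences of rounds that agree with `π` up to round `n`. -/
def cylinder (π : PlaySeq S E A) (n : ℕ) : Set (PlaySeq S E A) :=
  Preorder.frestrictLe n ⁻¹' {Preorder.frestrictLe n π}

/-- The states visited in the rounds `0, …, n`. -/
def history (π : PlaySeq S E A) (n : ℕ) : List S :=
  (List.range (n + 1)).map fun i => (π i).state

theorem statesOf_frestrictLe (π : PlaySeq S E A) (n : ℕ) :
    statesOf (Preorder.frestrictLe (π := fun _ => Round S E A) n π) = history π n := by
  apply List.ext_getElem
  · simp [statesOf, history]
  · intro i h₁ h₂
    simp only [statesOf, history, List.getElem_ofFn, List.getElem_map, List.getElem_range]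
    rfl

theorem history_succ (π : PlaySeq S E A) (n : ℕ) :
    history π (n + 1) = history π n ++ [(π (n + 1)).state] := by
  rw [history, List.range_succ, List.map_append]; rfl

theorem history_congr {π π' : PlaySeq S E A} {n : ℕ} (h : ∀ i ≤ n, π i = π' i) :
    history π n = history π' n := by
  refine List.map_congr_left fun i hi => ?_
  rw [h i (Nat.lt_succ_iff.1 (List.mem_range.1 hi))]

theorem mem_cylinder {π π' : PlaySeq S E A} {n : ℕ} :
    π' ∈ cylinder π n ↔ ∀ i ≤ n, π' i = π i := by
  simp only [cylinder, Set.mem_preimage, Set.mem_singleton_iff, funext_iff, Subtype.forall,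
    Finset.mem_Iic, Preorder.frestrictLe_apply]

variable (s₀ : S) (φ : 𝒜.StrategyE) (ψ : 𝒜.StrategyA)

/-- The rounds of positive conditional probability: the transition has positive probability and
both players follow their strategies. -/
theorem nextRound_pos (π : PlaySeq S E A) (n : ℕ) (r : Round S E A) :
    0 < 𝒜.nextRound φ ψ (Preorder.frestrictLe (π := fun _ => Round S E A) n π) r ↔
      0 < 𝒜.δ (π n).state (π n).eve (π n).adam r.state ∧
        r = 𝒜.roundAfter φ ψ (history π n) r.state := by
  rw [pos_iff_ne_zero, ← PMF.mem_support_iff, nextRound, PMF.mem_support_map_iff,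
    statesOf_frestrictLe]
  constructor
  · rintro ⟨s, hs, rfl⟩
    exact ⟨pos_iff_ne_zero.2 ((PMF.mem_support_iff _ _).1 hs), rfl⟩
  · rintro ⟨hs, hr⟩
    exact ⟨r.state, (PMF.mem_support_iff _ _).2 hs.ne', hr.symm⟩

variable [Finite S] [Finite E] [Finite A]

/-- The chain rule for cylinders: by the Ionescu-Tulcea construction, the joint law of the rounds up
to `n` and of round `n + 1` is the composition-product with the kernel. -/
theorem prob_cylinder_succ (π : PlaySeq S E A) (n : ℕ) :
    𝒜.prob s₀ φ ψ (cylinder π (n + 1)) = 𝒜.prob s₀ φ ψ (cylinder π n) *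
      𝒜.nextRound φ ψ (Preorder.frestrictLe n π) (π (n + 1)) := by
  have key := Kernel.partialTraj_compProd_eq_map_traj (X := fun _ => Round S E A)
    (κ := 𝒜.kernel φ ψ) (Nat.zero_le n)
    (x₀ := fun _ => 𝒜.roundAfter φ ψ [] s₀)
  have h := congrArg (fun μ : Measure _ =>
    μ ({Preorder.frestrictLe n π} ×ˢ {π (n + 1)})) key
  beta_reduce at h
  have ms : MeasurableSet ({Preorder.frestrictLe n π} : Set ((i : Finset.Iic n) → Round S E A)) :=
    measurableSet_singleton _
  rw [Measure.map_apply (by fun_prop) (ms.prod (measurableSet_singleton _)),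
    Measure.compProd_apply_prod ms (measurableSet_singleton _),
    ← Kernel.traj_map_frestrictLe_apply, Measure.restrict_singleton, lintegral_smul_measure,
    lintegral_dirac, Measure.map_apply (by fun_prop) ms] at h
  have e : (fun x : PlaySeq S E A =>
      (Preorder.frestrictLe (π := fun _ => Round S E A) n x, x (n + 1))) ⁻¹'
        ({Preorder.frestrictLe n π} ×ˢ {π (n + 1)}) = cylinder π (n + 1) := by
    ext x
    rw [mem_cylinder]
    have := mem_cylinder (π := π) (π' := x) (n := n)
    rw [cylinder, Set.mem_preimage] at this
    rw [Set.mem_preimage, Set.mem_prod, this]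
    constructor
    · rintro ⟨h₁, h₂⟩ i hi
      rcases Nat.le_succ_iff.1 hi with hi | rfl
      · exact h₁ i hi
      · exact h₂
    · exact fun h => ⟨fun i hi => h i (by omega), h _ le_rfl⟩
  rw [e] at h
  have hk : 𝒜.kernel φ ψ n (Preorder.frestrictLe n π) {π (n + 1)} =
      𝒜.nextRound φ ψ (Preorder.frestrictLe n π) (π (n + 1)) := by
    simp [kernel, Kernel.ofFunOfCountable, PMF.toMeasure_apply_singleton]
  rw [hk] at h
  exact h.symm

open Classical in
theorem prob_cylinder_zero (π : PlaySeq S E A) :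
    0 < 𝒜.prob s₀ φ ψ (cylinder π 0) ↔ π 0 = 𝒜.roundAfter φ ψ [] s₀ := by
  have key := Kernel.traj_map_frestrictLe_apply (X := fun _ => Round S E A)
    (κ := 𝒜.kernel φ ψ) 0 0
    (fun _ => 𝒜.roundAfter φ ψ [] s₀)
  rw [Kernel.partialTraj_self, Kernel.id_apply] at key
  have ms : MeasurableSet ({Preorder.frestrictLe 0 π} : Set ((i : Finset.Iic 0) → Round S E A)) :=
    measurableSet_singleton _
  have h := congrArg (fun μ : Measure _ => μ {Preorder.frestrictLe 0 π}) key
  beta_reduce at h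
  rw [Measure.map_apply (by fun_prop) ms, Measure.dirac_apply' _ ms] at h
  change 𝒜.prob s₀ φ ψ (cylinder π 0) = _ at h
  rw [h, Set.indicator_apply]
  have : (fun _ : Finset.Iic 0 => 𝒜.roundAfter φ ψ [] s₀) ∈
      ({Preorder.frestrictLe 0 π} : Set ((i : Finset.Iic 0) → Round S E A)) ↔
      π 0 = 𝒜.roundAfter φ ψ [] s₀ := by
    rw [Set.mem_singleton_iff, funext_iff]
    constructor
    · intro h; exact (h ⟨0, by simp⟩).symm
    · rintro h ⟨i, hi⟩
      obtain rfl : i = 0 := by simpa using hi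
      exact h.symm
  rw [← this]
  split_ifs with hm <;> simp [hm]

/-- Almost surely, all finite prefixes of the play have positive probability. -/
theorem ae_prob_cylinder_pos :
    ∀ᵐ π ∂𝒜.prob s₀ φ ψ, ∀ n, 0 < 𝒜.prob s₀ φ ψ (cylinder π n) := by
  rw [ae_all_iff]
  intro n
  rw [ae_iff]
  have : {π : PlaySeq S E A | ¬ 0 < 𝒜.prob s₀ φ ψ (cylinder π n)} ⊆
      ⋃ h ∈ {h : (i : Finset.Iic n) → Round S E A |
        𝒜.prob s₀ φ ψ (Preorder.frestrictLe n ⁻¹' {h}) = 0},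
        (Preorder.frestrictLe n ⁻¹' {h} : Set (PlaySeq S E A)) := by
    intro π hπ
    simp only [Set.mem_ofPred_eq, not_lt, nonpos_iff_eq_zero] at hπ
    simp only [Set.mem_iUnion]
    exact ⟨Preorder.frestrictLe n π, hπ, rfl⟩
  refine measure_mono_null this ?_
  rw [measure_biUnion_null_iff (Set.to_countable _)]
  exact fun h hh => hh

theorem round_eq_of_prob_cylinder_pos {π : PlaySeq S E A}
    (n : ℕ) (h : 0 < 𝒜.prob s₀ φ ψ (cylinder π n)) :
    (π n).eve = φ ((history π n).map (Quotient.mk 𝒜.simE)) ∧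
    (π n).adam = ψ ((history π n).map (Quotient.mk 𝒜.simA)) := by
  cases n with
  | zero =>
    rw [prob_cylinder_zero] at h
    simp [history, h, roundAfter]
  | succ n =>
    rw [prob_cylinder_succ] at h
    have := (pos_of_mul_pos_right h zero_le)
    rw [nextRound_pos] at this
    rw [history_succ, this.2]
    exact ⟨rfl, rfl⟩

end Cylinders

section Forces

variable {S E A : Type} (𝒜 : Arena S E A) (F : Set S)

/-- When Eve uses `φ`, has observed `w` and the current state is `s`, then against every behaviour
of Adam some play of positive probability reaches `F` in at most `n` more rounds. -/
def Forces (φ : 𝒜.StrategyE) : ℕ → List 𝒜.ObsE → S → Prop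
  | 0, _, s => s ∈ F
  | n + 1, w, s => s ∈ F ∨ ∀ a, ∃ s', 0 < 𝒜.δ s (φ w) a s' ∧
      Forces φ n (w ++ [Quotient.mk 𝒜.simE s']) s'

variable {𝒜 F} {φ : 𝒜.StrategyE}

theorem Forces.succ {n : ℕ} : ∀ {w : List 𝒜.ObsE} {s : S}, 𝒜.Forces F φ n w s →
    𝒜.Forces F φ (n + 1) w s := by
  induction n with
  | zero => exact fun h => Or.inl h
  | succ n ih =>
    rintro w s (h | h)
    · exact Or.inl h
    · refine Or.inr fun a => ?_
      obtain ⟨s', h₁, h₂⟩ := h a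
      exact ⟨s', h₁, ih h₂⟩

theorem Forces.mono {m n : ℕ} (hmn : m ≤ n) {w : List 𝒜.ObsE} {s : S}
    (h : 𝒜.Forces F φ m w s) : 𝒜.Forces F φ n w s := by
  induction hmn with
  | refl => exact h
  | step _ ih => exact ih.succ

/-- As Adam has finitely many actions, in a state from which reaching `F` is not forced within any
number of rounds he has an action after which this is still so. -/
theorem exists_action_of_not_forces [Finite A] {w : List 𝒜.ObsE} {s : S}
    (h : ∀ n, ¬ 𝒜.Forces F φ n w s) :
    ∃ a, ∀ s', 0 < 𝒜.δ s (φ w) a s' →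
      ∀ n, ¬ 𝒜.Forces F φ n (w ++ [Quotient.mk 𝒜.simE s']) s' := by
  by_contra! hc
  choose f hf n hn using hc
  have := Fintype.ofFinite A
  refine h (Finset.univ.sup n + 1) (Or.inr fun a => ⟨f a, hf a, (hn a).mono ?_⟩)
  exact Finset.le_sup (Finset.mem_univ a)

variable [Finite S] [Finite E] [Finite A]

/-- Along a cylinder of positive probability, the successor that makes progress against Adam's
action extends it to a longer cylinder of positive probability. -/
theorem prob_reach_pos_of_forces (s₀ : S) (ψ : 𝒜.StrategyA) (k : ℕ) :
    ∀ (n : ℕ) (π : PlaySeq S E A), 0 < 𝒜.prob s₀ φ ψ (cylinder π n) →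
      𝒜.Forces F φ k ((history π n).map (Quotient.mk 𝒜.simE)) (π n).state →
      0 < 𝒜.prob s₀ φ ψ (reach F) := by
  have base : ∀ (n : ℕ) (π : PlaySeq S E A), 0 < 𝒜.prob s₀ φ ψ (cylinder π n) →
      (π n).state ∈ F → 0 < 𝒜.prob s₀ φ ψ (reach F) := by
    intro n π h hF
    refine h.trans_le (measure_mono fun π' hπ' => ⟨n, ?_⟩)
    rw [mem_cylinder.1 hπ' n le_rfl]
    exact hF
  induction k with
  | zero => exact base
  | succ k ih =>
    rintro n π h (hF | hF)
    · exact base n π h hF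
    · obtain ⟨s', h₁, h₂⟩ := hF (π n).adam
      have hr := 𝒜.round_eq_of_prob_cylinder_pos s₀ φ ψ n h
      set π' := Function.update π (n + 1) (𝒜.roundAfter φ ψ (history π n) s') with hπ'
      have agree : ∀ i ≤ n, π' i = π i := fun i hi =>
        Function.update_of_ne (by omega) _ _
      have last : π' (n + 1) = 𝒜.roundAfter φ ψ (history π n) s' := Function.update_self ..
      have hist := history_congr agree
      have cyl : cylinder π' n = cylinder π n := by
        ext x
        simp only [mem_cylinder]
        exact forall₂_congr fun i hi => by rw [agree i hi]
      refine ih (n + 1) π' ?_ ?_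
      · rw [prob_cylinder_succ, cyl]
        refine ENNReal.mul_pos h.ne' (LT.lt.ne' ?_)
        rw [nextRound_pos, hist, agree n le_rfl, last]
        refine ⟨?_, rfl⟩
        rw [hr.1]
        exact h₁
      · rw [history_succ, hist, last, List.map_append]
        exact h₂

/-- A strategy is positively winning iff, from every initial state, it forces the play to have a
positive probability of reaching `F` within a fixed number of rounds. If this fails then Adam, who
observes the state, can play so that it fails forever. -/
theorem positivelyWinning_iff (hA : 𝒜.AdamPerfectlyInformed) (K : Set S) :
    𝒜.PositivelyWinning K F φ ↔
      ∀ s₀ ∈ K, ∃ n, 𝒜.Forces F φ n [Quotient.mk 𝒜.simE s₀] s₀ := by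
  classical
  refine forall₂_congr fun s₀ hs₀ => ⟨fun h => ?_, ?_⟩
  · by_contra! hc
    -- without actions of Adam, everything would be forced
    have hne : Nonempty A := by
      by_contra hA'
      exact hc 1 (Or.inr fun a => (hA' ⟨a⟩).elim)
    have ex : ∀ (w : List 𝒜.ObsE) (s : S), ∃ a, (∀ n, ¬ 𝒜.Forces F φ n w s) →
        ∀ s', 0 < 𝒜.δ s (φ w) a s' →
          ∀ n, ¬ 𝒜.Forces F φ n (w ++ [Quotient.mk 𝒜.simE s']) s' := by
      intro w s
      by_cases hw : ∀ n, ¬ 𝒜.Forces F φ n w s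
      · obtain ⟨a, ha⟩ := exists_action_of_not_forces hw
        exact ⟨a, fun _ => ha⟩
      · exact ⟨hne.some, fun h => (hw h).elim⟩
    choose act hact using ex
    -- Adam's observations determine the states
    let st : 𝒜.ObsA → S := Quotient.out
    have hst : ∀ s, st (Quotient.mk 𝒜.simA s) = s := fun s =>
      (hA _ _).1 (Quotient.exact (Quotient.out_eq (Quotient.mk 𝒜.simA s)))
    let ψ : 𝒜.StrategyA := fun l =>
      act ((l.map st).map (Quotient.mk 𝒜.simE)) (((l.map st).getLast?).getD s₀)
    have hψ : ∀ l s, ψ ((l ++ [s]).map (Quotient.mk 𝒜.simA)) =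
        act ((l ++ [s]).map (Quotient.mk 𝒜.simE)) s := by
      intro l s
      have : ((l ++ [s]).map (Quotient.mk 𝒜.simA)).map st = l ++ [s] := by
        rw [List.map_map]
        conv_rhs => rw [← List.map_id (l ++ [s])]
        exact List.map_congr_left fun x _ => hst x
      simp only [ψ, this]
      simp
    refine (h ψ).ne' ?_
    have hae := 𝒜.ae_prob_cylinder_pos s₀ φ ψ
    refine measure_mono_null ?_ (ae_iff.1 hae)
    rintro π ⟨m, hm⟩ hπ
    -- along the plays all of whose prefixes have positive probability, `F` is never forced
    have inv : ∀ n, ∀ k, ¬ 𝒜.Forces F φ k ((history π n).map (Quotient.mk 𝒜.simE))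
        (π n).state := by
      intro n
      induction n with
      | zero =>
        have := (𝒜.prob_cylinder_zero s₀ φ ψ π).1 (hπ 0)
        simpa [history, this, roundAfter] using hc
      | succ n ih =>
        have h₁ := 𝒜.round_eq_of_prob_cylinder_pos s₀ φ ψ n (hπ n)
        have h₂ := hπ (n + 1)
        rw [prob_cylinder_succ] at h₂
        have h₃ := (𝒜.nextRound_pos φ ψ π n _).1 (pos_of_mul_pos_right h₂ zero_le)
        have hl : ∃ l, history π n = l ++ [(π n).state] := by
          cases n with
          | zero => exact ⟨[], rfl⟩
          | succ n => exact ⟨_, history_succ π n⟩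
        obtain ⟨l, hl⟩ := hl
        have h₄ : (π n).adam = act ((history π n).map (Quotient.mk 𝒜.simE)) (π n).state := by
          rw [h₁.2, hl, hψ]
        have h₅ := h₃.1
        rw [h₁.1, h₄] at h₅
        rw [history_succ, List.map_append]
        exact hact _ _ ih _ h₅
    exact inv m 0 hm
  · rintro ⟨n, hn⟩ ψ
    exact prob_reach_pos_of_forces s₀ ψ n 0 (fun _ => 𝒜.roundAfter φ ψ [] s₀)
      ((prob_cylinder_zero ..).2 rfl) hn

end Forces

end Arena

end ConcurrentGame

/-! ### Enumerating the subsets of a finite set -/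

namespace ConcurrentGame

/-- All the pairs of an element of `l` and a subset of `Fin n`. -/
def pairsWithSubset {β : Type} (l : List β) : (n : ℕ) → List (β × (Fin n → Bool))
  | 0 => l.map fun b => (b, Fin.elim0)
  | n + 1 =>
    (pairsWithSubset l n).map (fun p => (p.1, Fin.cons false p.2)) ++
      (pairsWithSubset l n).map (fun p => (p.1, Fin.cons true p.2))

theorem length_pairsWithSubset {β : Type} (l : List β) (n : ℕ) :
    (pairsWithSubset l n).length = l.length * 2 ^ n := by
  induction n with
  | zero => simp [pairsWithSubset]
  | succ n ih => simp [pairsWithSubset, ih, pow_succ]; ring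

theorem mem_pairsWithSubset {β : Type} {l : List β} (hl : ∀ b, b ∈ l) {n : ℕ}
    (p : β × (Fin n → Bool)) : p ∈ pairsWithSubset l n := by
  induction n with
  | zero =>
    obtain ⟨b, B⟩ := p
    simp only [pairsWithSubset, List.mem_map]
    exact ⟨b, hl b, by congr; exact Subsingleton.elim _ _⟩
  | succ n ih =>
    obtain ⟨b, B⟩ := p
    have hB : Fin.cons (B 0) (fun i => B i.succ) = B := Fin.cons_self_tail B
    simp only [pairsWithSubset, List.mem_append, List.mem_map]
    cases h : B 0
    · exact Or.inl ⟨(b, fun i => B i.succ), ih _, by rw [← h, hB]⟩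
    · exact Or.inr ⟨(b, fun i => B i.succ), ih _, by rw [← h, hB]⟩

/-- An increasing sequence of subsets of a finite type in which every repetition propagates is
constant from the cardinality of the type on. -/
theorem chain_stable {α : Type} [Fintype α] (W : ℕ → Set α) (mono : ∀ k, W k ⊆ W (k + 1))
    (prop : ∀ k, W (k + 1) = W k → W (k + 2) = W (k + 1)) {n : ℕ} (hn : Fintype.card α = n) :
    W (n + 1) = W n := by
  by_contra hne
  have hne' : ∀ j k, j + k = n → W (k + 1) ≠ W k := by
    intro j
    induction j with
    | zero => rintro k hk; obtain rfl : k = n := by omega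
              exact hne
    | succ j ih => exact fun k hk he => ih (k + 1) (by omega) (prop k he)
  -- otherwise the sets increase strictly, and the set number `n + 1` has too many elements
  have card : ∀ k, k ≤ n + 1 → k ≤ (W k).ncard := by
    intro k
    induction k with
    | zero => simp
    | succ k ih =>
      intro hk
      have hss : W k ⊂ W (k + 1) :=
        (mono k).ssubset_of_ne (hne' (n - k) k (by omega)).symm
      have := Set.ncard_lt_ncard hss (Set.toFinite _)
      have := ih (by omega)
      omega
  have h₁ := card (n + 1) le_rfl
  have h₂ := Set.ncard_le_card (W (n + 1))
  rw [Nat.card_eq_fintype_card] at h₂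
  omega

/-! ### The obligation game -/

namespace Instance

variable (I : Instance)

/-- Positions of the obligation game: the state of the automaton, and the set of the states from
which Eve is committed to reach `F` with positive probability. -/
abbrev Pos := Fin I.nQ × (Fin I.nS → Bool)

/-- Moves of the obligation game: an action of Eve, and a set of states that the play shall hit
with positive probability in the next round, whatever Adam does and from each of the states to
which Eve is committed. -/
abbrev Move := Fin I.nE × (Fin I.nS → Bool)

open Classical in
/-- The states of `C` outside `F` that look like `x`. -/
noncomputable def restrict (C : Fin I.nS → Bool) (x : I.arena.ObsE) : Fin I.nS → Bool :=
  fun t => decide (C t = true ∧ t ∉ I.F ∧ Quotient.mk I.arena.simE t = x)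

/-- The position after the move `m` and the observation `x`. -/
noncomputable def nextPos (q : Fin I.nQ) (m : I.Move) (x : I.arena.ObsE) : I.Pos :=
  (I.T.δ q m.1 x, I.restrict m.2 x)

open Classical in
/-- The position after the initial observation. -/
noncomputable def initPos (x : I.arena.ObsE) : I.Pos :=
  (I.T.q₀, I.restrict (fun t => decide (t ∈ I.K)) x)

/-- The move `m` is legal at `v` and leads only to positions in `W`. -/
def Good (W : I.Pos → Prop) (v : I.Pos) (m : I.Move) : Prop :=
  m.1 ∈ I.T.act v.1 ∧
    (∀ s, v.2 s = true → ∀ a, ∃ s', m.2 s' = true ∧ I.weight s m.1 a s' ≠ 0) ∧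
    ∀ s, m.2 s = true → W (I.nextPos v.1 m (Quotient.mk I.arena.simE s))

/-- The list of all positions. -/
def positions : List I.Pos := pairsWithSubset (List.finRange I.nQ) I.nS

/-- The list of all moves. -/
def moves : List I.Move := pairsWithSubset (List.finRange I.nE) I.nS

open Classical in
/-- The partial positional strategy found in `k` rounds of the attractor computation: a position
receives the first good move, once there is one, and keeps it. -/
noncomputable def choice : ℕ → I.Pos → Option I.Move
  | 0, _ => none
  | k + 1, v => (choice k v).or
      (I.moves.find? fun m => decide (I.Good (fun v' => choice k v' ≠ none) v m))

/-- The positions that are won within `k` rounds of the attractor computation. -/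
def wonAt (k : ℕ) : Set I.Pos := {v | I.choice k v ≠ none}

/-- The positional strategy after as many rounds as there are positions. -/
noncomputable def solution : I.Pos → Option I.Move := I.choice I.positions.length

/-- The winning positions. -/
def won : Set I.Pos := {v | I.solution v ≠ none}

/-- The move of the positional strategy, with a default value at positions that are not won. -/
noncomputable def moveAt (v : I.Pos) : I.Move :=
  (I.solution v).getD (⟨0, I.nE_pos⟩, fun _ => false)

theorem mem_positions (v : I.Pos) : v ∈ I.positions :=
  mem_pairsWithSubset (List.mem_finRange) v

theorem mem_moves (m : I.Move) : m ∈ I.moves :=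
  mem_pairsWithSubset (List.mem_finRange) m

theorem length_positions : I.positions.length = I.nQ * 2 ^ I.nS := by
  rw [positions, length_pairsWithSubset, List.length_finRange]

variable {I}

theorem Good.mono {W W' : I.Pos → Prop} (h : ∀ v, W v → W' v) {v : I.Pos} {m : I.Move}
    (hg : I.Good W v m) : I.Good W' v m :=
  ⟨hg.1, hg.2.1, fun s hs => h _ (hg.2.2 s hs)⟩

theorem choice_mono {j k : ℕ} (hjk : j ≤ k) {v : I.Pos} {m : I.Move}
    (h : I.choice j v = some m) : I.choice k v = some m := by
  induction hjk with
  | refl => exact h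
  | step _ ih => rw [choice, ih]; rfl

theorem wonAt_mono {j k : ℕ} (hjk : j ≤ k) : I.wonAt j ⊆ I.wonAt k := by
  intro v hv
  obtain ⟨m, hm⟩ := Option.ne_none_iff_exists'.1 hv
  exact Option.ne_none_iff_exists'.2 ⟨m, choice_mono hjk hm⟩

open Classical in
theorem mem_wonAt_succ {k : ℕ} {v : I.Pos} :
    v ∈ I.wonAt (k + 1) ↔ v ∈ I.wonAt k ∨ ∃ m, I.Good (· ∈ I.wonAt k) v m := by
  change I.choice (k + 1) v ≠ none ↔ _
  rw [choice, Ne, Option.or_eq_none_iff, not_and_or, List.find?_eq_none]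
  refine or_congr Iff.rfl ?_
  push Not
  constructor
  · rintro ⟨m, -, hm⟩
    rw [decide_eq_true_eq] at hm
    exact ⟨m, hm⟩
  · rintro ⟨m, hm⟩
    exact ⟨m, I.mem_moves m, by rw [decide_eq_true_eq]; exact hm⟩

open Classical in
/-- The move that is recorded at a position leads to positions that were won earlier. -/
theorem exists_good_of_choice {k : ℕ} {v : I.Pos} {m : I.Move} (h : I.choice k v = some m) :
    ∃ j < k, I.Good (· ∈ I.wonAt j) v m := by
  induction k with
  | zero => simp [choice] at h
  | succ k ih =>
    rw [choice, Option.or_eq_some_iff] at h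
    rcases h with h | ⟨-, h⟩
    · obtain ⟨j, hj, hg⟩ := ih h
      exact ⟨j, by omega, hg⟩
    · have hg := List.find?_some h
      rw [decide_eq_true_eq] at hg
      exact ⟨k, by omega, hg⟩

theorem wonAt_stable : I.wonAt (I.positions.length + 1) = I.wonAt I.positions.length := by
  refine chain_stable I.wonAt (fun k => wonAt_mono (Nat.le_succ k)) (fun k hk => ?_) ?_
  · ext v
    rw [mem_wonAt_succ, hk, ← mem_wonAt_succ, hk]
  · rw [length_positions]
    simp

/-- The winning positions are closed under good moves. -/
theorem mem_won_of_good {v : I.Pos} {m : I.Move} (h : I.Good (· ∈ I.won) v m) : v ∈ I.won := by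
  change v ∈ I.wonAt _
  rw [← wonAt_stable, mem_wonAt_succ]
  exact Or.inr ⟨m, h⟩

theorem restrict_eq_true {C : Fin I.nS → Bool} {x : I.arena.ObsE} {t : Fin I.nS} :
    I.restrict C x t = true ↔ C t = true ∧ t ∉ I.F ∧ Quotient.mk I.arena.simE t = x := by
  simp [restrict]

theorem initPos_eq_true {x : I.arena.ObsE} {t : Fin I.nS} :
    (I.initPos x).2 t = true ↔ t ∈ I.K ∧ t ∉ I.F ∧ Quotient.mk I.arena.simE t = x := by
  simp [initPos, restrict_eq_true]

theorem δ_pos_iff {s : Fin I.nS} {σ : Fin I.nE} {a : Fin I.nA} {s' : Fin I.nS} :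
    0 < I.arena.δ s σ a s' ↔ I.weight s σ a s' ≠ 0 := by
  rw [I.arena_δ, pos_iff_ne_zero, Ne, ENNReal.coe_eq_zero]
  simp

/-! ### Winning strategies win the obligation game -/

/-- `w` and `q` are the observations and the state of the automaton along a partial play that
starts in `K`, respects `φ` and ends in `s`. -/
def Reached (φ : I.arena.StrategyE) (w : List I.arena.ObsE) (q : Fin I.nQ) (s : Fin I.nS) : Prop :=
  ∃ lam : PartialPlay (Fin I.nS) (Fin I.nE) (Fin I.nA), lam.first ∈ I.K ∧
    I.arena.IsPartialPlay lam ∧ I.arena.EveRespects φ lam ∧ I.arena.obsE lam = w ∧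
    I.T.run lam = q ∧ lam.last = s

theorem Reached.step {φ : I.arena.StrategyE} {w : List I.arena.ObsE} {q : Fin I.nQ}
    {s s' : Fin I.nS} (h : Reached φ w q s) {a : Fin I.nA} (hs' : 0 < I.arena.δ s (φ w) a s') :
    Reached φ (w ++ [Quotient.mk I.arena.simE s'])
      (I.T.δ q (φ w) (Quotient.mk I.arena.simE s')) s' := by
  obtain ⟨lam, h₁, h₂, h₃, rfl, rfl, rfl⟩ := h
  refine ⟨.step lam (φ (I.arena.obsE lam)) a s', h₁, ⟨h₂, hs'⟩, ⟨h₃, rfl⟩, ?_, rfl, rfl⟩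
  simp [Arena.obsE, PartialPlay.states]

open Classical in
/-- The states to which Eve is committed after the observations `w` share the observations, hence
her action; the next obligations are the successors by which she forces a visit to `F`. -/
theorem mem_won_of_forces {φ : I.arena.StrategyE} (hφ : I.T.Compatible I.K φ) (n : ℕ) :
    ∀ (w : List I.arena.ObsE) (v : I.Pos), (∃ s, Reached φ w v.1 s) →
      (∀ s, v.2 s = true → s ∉ I.F ∧ I.arena.Forces I.F φ n w s ∧ Reached φ w v.1 s) →
      v ∈ I.won := by
  induction n with
  | zero =>
    rintro w v ⟨s, lam, h₁, h₂, h₃, rfl, hq, -⟩ hv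
    refine mem_won_of_good (m := (φ (I.arena.obsE lam), fun _ => false)) ⟨?_, ?_, by simp⟩
    · rw [← hq]; exact hφ lam h₁ h₂ h₃
    · intro s hs
      exact absurd (hv s hs).2.1 (hv s hs).1
  | succ n ih =>
    rintro w v ⟨s, lam, h₁, h₂, h₃, hw, hq, -⟩ hv
    let C : Fin I.nS → Bool := fun s' => decide (∃ s a, v.2 s = true ∧
      0 < I.arena.δ s (φ w) a s' ∧
      I.arena.Forces I.F φ n (w ++ [Quotient.mk I.arena.simE s']) s')
    have hC : ∀ s', C s' = true →
        Reached φ (w ++ [Quotient.mk I.arena.simE s'])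
          (I.T.δ v.1 (φ w) (Quotient.mk I.arena.simE s')) s' ∧
        I.arena.Forces I.F φ n (w ++ [Quotient.mk I.arena.simE s']) s' := by
      intro s' hs'
      obtain ⟨s, a, hs, hδ, hf⟩ := of_decide_eq_true hs'
      exact ⟨(hv s hs).2.2.step hδ, hf⟩
    refine mem_won_of_good (m := (φ w, C)) ⟨?_, fun s hs a => ?_, fun s' hs' => ?_⟩
    · rw [← hq, ← hw]; exact hφ lam h₁ h₂ h₃
    · obtain ⟨hF, hf, -⟩ := hv s hs
      obtain ⟨s', hδ, hf'⟩ := hf.resolve_left hF a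
      exact ⟨s', decide_eq_true ⟨s, a, hs, hδ, hf'⟩, δ_pos_iff.1 hδ⟩
    · refine ih (w ++ [Quotient.mk I.arena.simE s']) _ ⟨s', (hC s' hs').1⟩ fun t ht => ?_
      obtain ⟨ht₁, ht₂, ht₃⟩ := restrict_eq_true.1 ht
      have := hC t ht₁
      rw [ht₃] at this
      exact ⟨ht₂, this.2, this.1⟩

/-- The number of rounds after which `F` is forced is uniform over the finitely many initial states,
which Eve may be unable to distinguish. -/
theorem initPos_mem_won (hA : I.arena.AdamPerfectlyInformed) {φ : I.arena.StrategyE}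
    (hφ : I.WinningStrategy φ) {s : Fin I.nS} (hs : s ∈ I.K) :
    I.initPos (Quotient.mk I.arena.simE s) ∈ I.won := by
  obtain ⟨hc, hw⟩ := hφ
  rw [Arena.positivelyWinning_iff hA] at hw
  choose! n hn using hw
  refine mem_won_of_forces hc (Finset.univ.sup n) [Quotient.mk I.arena.simE s] _
    ⟨s, .start s, hs, trivial, trivial, rfl, rfl, rfl⟩ fun t ht => ?_
  obtain ⟨htK, ht₂, ht₃⟩ := initPos_eq_true.1 ht
  rw [← ht₃]
  exact ⟨ht₂, (hn t htK).mono (Finset.le_sup (Finset.mem_univ t)),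
    .start t, htK, trivial, trivial, rfl, rfl, rfl⟩

/-! ### The finite-memory strategy -/

/-- A winning position is won by its recorded move, which leads to winning positions, whatever Eve
observes. An observation outside the set of the move leads to a position without obligations, which
is won because the automaton does not reach the sink by an admissible action. -/
theorem moveAt_spec {v : I.Pos} (hv : v ∈ I.won) :
    (I.moveAt v).1 ∈ I.T.act v.1 ∧ ∀ x, I.nextPos v.1 (I.moveAt v) x ∈ I.won := by
  obtain ⟨m, hm⟩ := Option.ne_none_iff_exists'.1 hv
  have hmv : I.moveAt v = m := by rw [moveAt, hm]; rfl
  obtain ⟨j, hj, hg⟩ := exists_good_of_choice hm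
  rw [hmv]
  refine ⟨hg.1, fun x => ?_⟩
  by_cases hx : ∃ t, m.2 t = true ∧ Quotient.mk I.arena.simE t = x
  · obtain ⟨t, ht, rfl⟩ := hx
    exact wonAt_mono hj.le (hg.2.2 t ht)
  · have hne : I.T.act (I.T.δ v.1 m.1 x) ≠ ∅ := by
      rw [Ne, I.T.act_eq_empty_iff, I.T.δ_eq_sink_iff]
      exact not_not.2 hg.1
    obtain ⟨σ, hσ⟩ := Set.nonempty_iff_ne_empty.2 hne
    refine mem_won_of_good (m := (σ, fun _ => false)) ⟨hσ, fun s hs => ?_, by simp⟩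
    obtain ⟨h₁, -, h₂⟩ := restrict_eq_true.1 hs
    exact absurd ⟨s, h₁, h₂⟩ hx

variable (I)

theorem exists_index (v : I.Pos) :
    ((List.finRange I.positions.length).find? fun j => decide (I.positions[j] = v)).isSome := by
  rw [List.find?_isSome]
  obtain ⟨j, hj, h⟩ := List.getElem_of_mem (I.mem_positions v)
  exact ⟨⟨j, hj⟩, List.mem_finRange _, by simpa using h⟩

/-- The index of a position in the list of all positions. -/
def index (v : I.Pos) : Fin I.positions.length :=
  ((List.finRange I.positions.length).find? fun j => decide (I.positions[j] = v)).get
    (I.exists_index v)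

@[simp]
theorem positions_index (v : I.Pos) : I.positions[(I.index v : ℕ)] = v := by
  have h := List.find?_some (Option.some_get (I.exists_index v)).symm
  exact of_decide_eq_true h

/-- The automaton that keeps track of the position of the obligation game. It has an additional
initial state, because it reads the initial observation. -/
noncomputable def memory : FiniteMemory I.arena.ObsE (Fin I.nE) where
  size := I.positions.length + 1
  init := 0
  next m x := (Fin.cases (I.index (I.initPos x))
    (fun j => I.index (I.nextPos I.positions[j].1 (I.moveAt I.positions[j]) x)) m :
      Fin I.positions.length).succ
  out := Fin.cases ⟨0, I.nE_pos⟩ fun j => (I.moveAt I.positions[j]).1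

/-- After the observations `w` the memory holds the position `v`. -/
def Tracks (w : List I.arena.ObsE) (v : I.Pos) : Prop :=
  w.foldl I.memory.next I.memory.init = (I.index v).succ

variable {I}

theorem tracks_init (x : I.arena.ObsE) : I.Tracks [x] (I.initPos x) := rfl

theorem Tracks.next {w : List I.arena.ObsE} {v : I.Pos} (h : I.Tracks w v) (x : I.arena.ObsE) :
    I.Tracks (w ++ [x]) (I.nextPos v.1 (I.moveAt v) x) := by
  rw [Tracks, List.foldl_append, h]
  simp [memory]

theorem Tracks.strategy_eq {w : List I.arena.ObsE} {v : I.Pos} (h : I.Tracks w v) :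
    I.memory.strategy w = (I.moveAt v).1 := by
  rw [FiniteMemory.strategy, h]
  simp [memory]

/-- Along the recorded moves, positions are won ever earlier, so the obligations are met. -/
theorem forces_of_choice (k : ℕ) (hk : k ≤ I.positions.length) :
    ∀ (w : List I.arena.ObsE) (v : I.Pos), I.Tracks w v → v ∈ I.wonAt k → ∀ s, v.2 s = true →
      I.arena.Forces I.F I.memory.strategy k w s := by
  induction k using Nat.strong_induction_on with
  | _ k ih =>
    intro w v hw hv s hs
    obtain ⟨m, hm⟩ := Option.ne_none_iff_exists'.1 hv
    have hmv : I.moveAt v = m := by rw [moveAt, solution, choice_mono hk hm]; rfl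
    obtain ⟨j, hj, hg⟩ := exists_good_of_choice hm
    refine Arena.Forces.mono (Nat.succ_le_of_lt hj) (Or.inr fun a => ?_)
    obtain ⟨s', hs', hδ⟩ := hg.2.1 s hs a
    refine ⟨s', ?_, ?_⟩
    · rw [hw.strategy_eq, hmv]
      exact δ_pos_iff.2 hδ
    · by_cases hF : s' ∈ I.F
      · exact Arena.Forces.mono (Nat.zero_le j) hF
      · have hn := hw.next (Quotient.mk I.arena.simE s')
        rw [hmv] at hn
        exact ih j hj (by omega) _ _ hn (hg.2.2 s' hs') s' (restrict_eq_true.2 ⟨hs', hF, rfl⟩)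

theorem winningStrategy_memory (hA : I.arena.AdamPerfectlyInformed)
    (h : ∀ s ∈ I.K, I.initPos (Quotient.mk I.arena.simE s) ∈ I.won) :
    I.WinningStrategy I.memory.strategy := by
  constructor
  · intro lam hK hp hr
    -- the memory holds a winning position with the current state of the automaton
    have inv : ∃ v, I.Tracks (I.arena.obsE lam) v ∧ v.1 = I.T.run lam ∧ v ∈ I.won := by
      clear hp
      induction lam with
      | start s => exact ⟨_, tracks_init _, rfl, h s hK⟩
      | step lam σ a s ih =>
        obtain ⟨v, h₁, h₂, h₃⟩ := ih hK hr.1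
        refine ⟨_, ?_, ?_, (moveAt_spec h₃).2 (Quotient.mk I.arena.simE s)⟩
        · have : I.arena.obsE (lam.step σ a s) =
              I.arena.obsE lam ++ [Quotient.mk I.arena.simE s] := by
            simp [Arena.obsE, PartialPlay.states]
          rw [this]
          exact h₁.next _
        · have : σ = (I.moveAt v).1 := by rw [hr.2, h₁.strategy_eq]
          rw [ActionAutomaton.run, ← h₂, this]
          rfl
    obtain ⟨v, h₁, h₂, h₃⟩ := inv
    rw [h₁.strategy_eq, ← h₂]
    exact (moveAt_spec h₃).1
  · rw [Arena.positivelyWinning_iff hA]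
    intro s hs
    by_cases hF : s ∈ I.F
    · exact ⟨0, hF⟩
    · exact ⟨I.positions.length, forces_of_choice _ le_rfl _ _ (tracks_init _) (h s hs) s
        (initPos_eq_true.2 ⟨hs, hF, rfl⟩)⟩

/-- The criterion to be decided. -/
theorem exists_winningStrategy_iff (hA : I.arena.AdamPerfectlyInformed) :
    (∃ φ, I.WinningStrategy φ) ↔
      ∀ s ∈ I.K, I.initPos (Quotient.mk I.arena.simE s) ∈ I.won :=
  ⟨fun ⟨_, hφ⟩ _ hs => initPos_mem_won hA hφ hs,
    fun h => ⟨_, winningStrategy_memory hA h⟩⟩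

end Instance

end ConcurrentGame

/-! ### Reading the input -/

namespace ConcurrentGame

open WhileLang

/-- Encoding of a subset of a finite set by its characteristic function. -/
def encSet {n : ℕ} (B : Fin n → Bool) : Data := encTable fun s => encBool (B s)

/-- Encoding of positions and moves. -/
def encPair {m n : ℕ} (p : Fin m × (Fin n → Bool)) : Data := .cons (encUnary p.1) (encSet p.2)

/-- A rational weight is zero iff its numerator is the empty list of digits; the digits are never
read, so their number does not matter. -/
theorem encRat_hd_eq_nil {r : ℚ≥0} : (encRat r).hd = .nil ↔ r = 0 := by
  have h₀ : r = 0 ↔ r.num = 0 := by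
    rw [← NNRat.coe_eq_zero, ← Rat.num_eq_zero, ← NNRat.natAbs_num_coe, Int.natAbs_eq_zero]
  rw [encRat, Data.hd, encBinary, h₀]
  constructor
  · intro h
    have hb : r.num.bits = [] := by
      cases hb : r.num.bits with
      | nil => rfl
      | cons b l => rw [hb] at h; simp [encList] at h
    rw [← Nat.size_eq_zero, ← Nat.size_eq_bits_len, hb]
    rfl
  · intro h
    simp [h, encList]

namespace Instance

/-- The parameters in which the running time is polynomial. -/
def params (I : Instance) : Fin 4 → ℕ := ![2 ^ I.nS, I.nQ, I.nE, I.nA]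

section Input

/-! The lemmas below speak of families `I` of inputs that can be computed from the context, rather
than of a fixed input: in the body of a loop the family is indexed by an input together with the
values of the loop variables. -/

variable {ι : Type} (I : ι → Instance)

theorem bound_nS : PolyBound (fun i => (I i).params) fun i => (I i).nS :=
  ⟨.X 0, fun i => by simpa [params] using Nat.lt_two_pow_self.le⟩

theorem bound_two_pow_nS : PolyBound (fun i => (I i).params) fun i => 2 ^ (I i).nS :=
  ⟨.X 0, fun i => by simp [params]⟩

theorem bound_nQ : PolyBound (fun i => (I i).params) fun i => (I i).nQ :=
  ⟨.X 1, fun i => by simp [params]⟩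

theorem bound_nE : PolyBound (fun i => (I i).params) fun i => (I i).nE :=
  ⟨.X 2, fun i => by simp [params]⟩

theorem bound_nA : PolyBound (fun i => (I i).params) fun i => (I i).nA :=
  ⟨.X 3, fun i => by simp [params]⟩

theorem bound_positions :
    PolyBound (fun i => (I i).params) fun i => (I i).positions.length :=
  ((bound_nQ I).mul (bound_two_pow_nS I)).of_le fun i => (length_positions (I i)).le

variable {I} {Γ : ι → Data}
  (hI : PolyComp (fun i => (I i).params) Γ fun i => (I i).encode)
include hI

theorem comp_nS : PolyComp (fun i => (I i).params) Γ fun i => encUnary (I i).nS := hI.hd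

theorem comp_nE : PolyComp (fun i => (I i).params) Γ fun i => encUnary (I i).nE := hI.tl.hd

theorem comp_nA : PolyComp (fun i => (I i).params) Γ fun i => encUnary (I i).nA := hI.tl.tl.hd

theorem comp_nQ : PolyComp (fun i => (I i).params) Γ fun i => encUnary (I i).nQ := hI.tl.tl.tl.hd

theorem comp_q₀ : PolyComp (fun i => (I i).params) Γ fun i => encUnary (I i).T.q₀ :=
  hI.tl.tl.tl.tl.tl.tl.tl.hd

variable {s t : ∀ i, Fin (I i).nS} {σ : ∀ i, Fin (I i).nE} {a : ∀ i, Fin (I i).nA}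
  {q : ∀ i, Fin (I i).nQ}
  (hs : PolyComp (fun i => (I i).params) Γ fun i => encUnary (s i))
  (ht : PolyComp (fun i => (I i).params) Γ fun i => encUnary (t i))
  (hσ : PolyComp (fun i => (I i).params) Γ fun i => encUnary (σ i))
  (ha : PolyComp (fun i => (I i).params) Γ fun i => encUnary (a i))
  (hq : PolyComp (fun i => (I i).params) Γ fun i => encUnary (q i))

include hs in
theorem dec_K : PolyDec (fun i => (I i).params) Γ fun i => s i ∈ (I i).K :=
  PolyComp.get (f := fun i s => encProp (s ∈ (I i).K))
    hI.tl.tl.tl.tl.tl.tl.tl.tl.tl.tl.tl.hd hs (bound_nS I)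

include hs in
theorem dec_F : PolyDec (fun i => (I i).params) Γ fun i => s i ∈ (I i).F :=
  PolyComp.get (f := fun i s => encProp (s ∈ (I i).F))
    hI.tl.tl.tl.tl.tl.tl.tl.tl.tl.tl.tl.tl.hd hs (bound_nS I)

include hσ hq in
theorem dec_act : PolyDec (fun i => (I i).params) Γ fun i => σ i ∈ (I i).T.act (q i) :=
  PolyComp.get (f := fun i σ => encProp (σ ∈ (I i).T.act (q i)))
    (PolyComp.get (f := fun i q => encTable fun σ => encProp (σ ∈ (I i).T.act q))
      hI.tl.tl.tl.tl.tl.tl.tl.tl.tl.tl.hd hq (bound_nQ I)) hσ (bound_nE I)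

include hs ht in
theorem dec_simE : PolyDec (fun i => (I i).params) Γ fun i =>
    Quotient.mk (I i).arena.simE (s i) = Quotient.mk (I i).arena.simE (t i) :=
  PolyDec.congr (P := fun i => (I i).arena.simE (s i) (t i))
    (PolyComp.get (f := fun i t => encProp ((I i).arena.simE (s i) t))
      (PolyComp.get (f := fun i s => encTable fun t => encProp ((I i).arena.simE s t))
        hI.tl.tl.tl.tl.tl.hd hs (bound_nS I)) ht (bound_nS I))
    fun _ => Quotient.eq.symm

include hs hσ hq in
theorem comp_δ : PolyComp (fun i => (I i).params) Γ fun i =>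
    encUnary ((I i).T.δ (q i) (σ i) (Quotient.mk (I i).arena.simE (s i))) :=
  PolyComp.get (f := fun i s => encUnary ((I i).T.δ (q i) (σ i) (Quotient.mk (I i).arena.simE s)))
    (PolyComp.get (f := fun i σ => encTable fun s =>
        encUnary ((I i).T.δ (q i) σ (Quotient.mk (I i).arena.simE s)))
      (PolyComp.get (f := fun i q => encTable fun σ => encTable fun s =>
          encUnary ((I i).T.δ q σ (Quotient.mk (I i).arena.simE s)))
        hI.tl.tl.tl.tl.tl.tl.tl.tl.tl.hd hq (bound_nQ I)) hσ (bound_nE I)) hs (bound_nS I)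

include hs ht hσ ha in
theorem dec_weight : PolyDec (fun i => (I i).params) Γ fun i =>
    (I i).weight (s i) (σ i) (a i) (t i) ≠ 0 :=
  ((PolyDec.isNil (PolyComp.get (f := fun i t => encRat ((I i).weight (s i) (σ i) (a i) t))
    (PolyComp.get (f := fun i a => encTable fun t => encRat ((I i).weight (s i) (σ i) a t))
      (PolyComp.get (f := fun i σ => encTable fun a => encTable fun t =>
          encRat ((I i).weight (s i) σ a t))
        (PolyComp.get (f := fun i s => encTable fun σ => encTable fun a => encTable fun t =>
            encRat ((I i).weight s σ a t))
          hI.tl.tl.tl.tl.hd hs (bound_nS I)) hσ (bound_nE I)) ha (bound_nA I)) ht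
    (bound_nS I)).hd).congr fun _ => encRat_hd_eq_nil).not

end Input

end Instance

end ConcurrentGame

namespace ConcurrentGame

open WhileLang

/-! ### The attractor construction as a program -/

theorem encSet_cons {n : ℕ} (b : Bool) (B : Fin n → Bool) :
    encSet (Fin.cons b B : Fin (n + 1) → Bool) = .cons (encBool b) (encSet B) := by
  simp [encSet, encTable, List.ofFn_succ, encList]

/-- The list is doubled once for each element of the set. -/
theorem polyEnum_pairsWithSubset {ι σ : Type} {N : ι → σ → ℕ} {Γ : ι → Data} {β : ι → Type}
    {l : ∀ i, List (β i)} {e : ∀ i, β i → Data} (hl : PolyEnum N Γ l e) {n : ι → ℕ}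
    (hn : PolyComp N Γ fun i => encUnary (n i)) (hb : PolyBound N fun i => 2 ^ n i) :
    PolyEnum N Γ (fun i => pairsWithSubset (l i) (n i))
      fun i p => .cons (e i p.1) (encSet p.2) := by
  refine ⟨?_, (hl.bound.mul hb).of_le fun i => (length_pairsWithSubset _ _).le⟩
  have h := PolyComp.iter (PolyEnum.unary hn (hb.of_le fun i => Nat.lt_two_pow_self.le))
    (fun i k => encList ((pairsWithSubset (l i) k).map
      fun p => Data.cons (e i p.1) (encSet p.2)))
    ((PolyComp.map hl (g := fun i b => .cons (e i b) .nil) (.cons .last .nil)).congr fun i => by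
      rw [pairsWithSubset, List.map_map]
      rfl) ?_
  · exact h.congr fun i => by rw [List.length_replicate]
  · let N' := fun p : Σ i, Fin (List.replicate (n i) Data.nil).length => N p.1
    have hacc : PolyEnum N' (fun p => .cons (Γ p.1) (.cons (encList
        ((pairsWithSubset (l p.1) p.2).map fun x => Data.cons (e p.1 x.1) (encSet x.2)))
          (List.replicate (n p.1) Data.nil)[p.2])) (fun p => pairsWithSubset (l p.1) p.2)
        fun p x => .cons (e p.1 x.1) (encSet x.2) :=
      ⟨PolyComp.id.tl.hd, ((hl.bound.mul hb).reindex Sigma.fst).of_le fun p => by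
        rw [length_pairsWithSubset]
        refine Nat.mul_le_mul_left _ (Nat.pow_le_pow_right (by omega) ?_)
        exact p.2.2.le.trans (List.length_replicate ..).le⟩
    refine (PolyComp.mapAppend hacc
      (g := fun p x => .cons (e p.1 x.1) (.cons .nil (encSet x.2)))
      (.cons PolyComp.last.hd (.cons .nil PolyComp.last.tl))
      (PolyComp.map hacc
        (g := fun p x => .cons (e p.1 x.1) (.cons (.cons .nil .nil) (encSet x.2)))
        (.cons PolyComp.last.hd (.cons .nilPair PolyComp.last.tl)))).congr fun p => ?_
    rw [pairsWithSubset, List.map_append, List.map_map, List.map_map]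
    refine congrArg encList (congrArg₂ _ ?_ ?_) <;>
    · refine List.map_congr_left fun x _ => ?_
      simp only [Function.comp_apply, encSet_cons]
      rfl

namespace Instance

section Algorithm

variable {ι : Type} {I : ι → Instance} {Γ : ι → Data}
  (hI : PolyComp (fun i => (I i).params) Γ fun i => (I i).encode)
include hI

theorem enum_positions :
    PolyEnum (fun i => (I i).params) Γ (fun i => (I i).positions) fun _ v => encPair v :=
  polyEnum_pairsWithSubset (PolyEnum.finRange (comp_nQ hI) (bound_nQ I)) (comp_nS hI)
    (bound_two_pow_nS I)

theorem enum_moves :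
    PolyEnum (fun i => (I i).params) Γ (fun i => (I i).moves) fun _ m => encPair m :=
  polyEnum_pairsWithSubset (PolyEnum.finRange (comp_nE hI) (bound_nE I)) (comp_nS hI)
    (bound_two_pow_nS I)

omit hI in
theorem dec_mem_set {B : ∀ i, Fin (I i).nS → Bool} {s : ∀ i, Fin (I i).nS}
    (hB : PolyComp (fun i => (I i).params) Γ fun i => encSet (B i))
    (hs : PolyComp (fun i => (I i).params) Γ fun i => encUnary (s i)) :
    PolyDec (fun i => (I i).params) Γ fun i => B i (s i) = true :=
  .of_bool (PolyComp.get (f := fun i s => encBool (B i s)) hB hs (bound_nS I))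

theorem dec_pos_eq {v v' : ∀ i, (I i).Pos}
    (hv : PolyComp (fun i => (I i).params) Γ fun i => encPair (v i))
    (hv' : PolyComp (fun i => (I i).params) Γ fun i => encPair (v' i)) :
    PolyDec (fun i => (I i).params) Γ fun i => v i = v' i := by
  have h₁ : PolyDec (fun i => (I i).params) Γ fun i => (v i).1 = (v' i).1 :=
    PolyDec.fin_eq hv.hd hv'.hd (bound_nQ I)
  have h₂ : PolyDec (fun i => (I i).params) Γ fun i =>
      ∀ s, (v i).2 s = true ↔ (v' i).2 s = true :=
    PolyDec.forall_fin (comp_nS hI) (bound_nS I)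
      ((dec_mem_set (I := fun p : Σ i, Fin (I i).nS => I p.1) (B := fun p => (v p.1).2)
          (s := fun p => p.2) (hv.tl.weaken) .last).iff
        (dec_mem_set (I := fun p : Σ i, Fin (I i).nS => I p.1) (B := fun p => (v' p.1).2)
          (s := fun p => p.2) (hv'.tl.weaken) .last))
  refine (h₁.and h₂).congr fun i => ?_
  rw [Prod.ext_iff, funext_iff]
  simp only [Bool.coe_iff_coe]

theorem comp_restrict {C : ∀ i, Fin (I i).nS → Bool} {s : ∀ i, Fin (I i).nS}
    (hC : PolyComp (fun i => (I i).params) Γ fun i => encSet (C i))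
    (hs : PolyComp (fun i => (I i).params) Γ fun i => encUnary (s i)) :
    PolyComp (fun i => (I i).params) Γ fun i =>
      encSet ((I i).restrict (C i) (Quotient.mk (I i).arena.simE (s i))) :=
  PolyComp.table (comp_nS hI) (bound_nS I) (PolyDec.bool (PolyDec.congr
    (PolyDec.and (dec_mem_set (I := fun p : Σ i, Fin (I i).nS => I p.1)
        (B := fun p => C p.1) (s := fun p => p.2) hC.weaken .last)
      (PolyDec.and
        (dec_F (I := fun p : Σ i, Fin (I i).nS => I p.1) (s := fun p => p.2)
          hI.weaken .last).not
        (dec_simE (I := fun p : Σ i, Fin (I i).nS => I p.1) (s := fun p => p.2)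
          (t := fun p => s p.1) hI.weaken .last hs.weaken)))
    fun _ => restrict_eq_true.symm))

theorem comp_nextPos {q : ∀ i, Fin (I i).nQ} {m : ∀ i, (I i).Move} {s : ∀ i, Fin (I i).nS}
    (hq : PolyComp (fun i => (I i).params) Γ fun i => encUnary (q i))
    (hm : PolyComp (fun i => (I i).params) Γ fun i => encPair (m i))
    (hs : PolyComp (fun i => (I i).params) Γ fun i => encUnary (s i)) :
    PolyComp (fun i => (I i).params) Γ fun i =>
      encPair ((I i).nextPos (q i) (m i) (Quotient.mk (I i).arena.simE (s i))) :=
  .cons (comp_δ (σ := fun i => (m i).1) hI hs hm.hd hq)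
    (comp_restrict (C := fun i => (m i).2) hI hm.tl hs)

theorem comp_initPos {s : ∀ i, Fin (I i).nS}
    (hs : PolyComp (fun i => (I i).params) Γ fun i => encUnary (s i)) :
    PolyComp (fun i => (I i).params) Γ fun i =>
      encPair ((I i).initPos (Quotient.mk (I i).arena.simE (s i))) :=
  .cons (comp_q₀ hI) (comp_restrict hI (PolyComp.table (comp_nS hI) (bound_nS I)
    (g := fun i s => encProp (s ∈ (I i).K))
    (dec_K (I := fun p : Σ i, Fin (I i).nS => I p.1) (s := fun p => p.2) hI.weaken .last)) hs)

theorem dec_exists_hit {m : ∀ i, (I i).Move} {s : ∀ i, Fin (I i).nS} {a : ∀ i, Fin (I i).nA}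
    (hm : PolyComp (fun i => (I i).params) Γ fun i => encPair (m i))
    (hs : PolyComp (fun i => (I i).params) Γ fun i => encUnary (s i))
    (ha : PolyComp (fun i => (I i).params) Γ fun i => encUnary (a i)) :
    PolyDec (fun i => (I i).params) Γ fun i =>
      ∃ s', (m i).2 s' = true ∧ (I i).weight (s i) (m i).1 (a i) s' ≠ 0 := by
  let I' := fun p : Σ i, Fin (I i).nS => I p.1
  have hσ : PolyComp (fun i => (I i).params) Γ fun i => encUnary (m i).1 := hm.hd
  exact PolyDec.exists_fin (comp_nS hI) (bound_nS I) (PolyDec.and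
    (dec_mem_set (I := I') (B := fun p => (m p.1).2) (s := fun p => p.2) hm.tl.weaken .last)
    (dec_weight (I := I') (s := fun p => s p.1) (σ := fun p => (m p.1).1) (a := fun p => a p.1)
      (t := fun p => p.2) hI.weaken hs.weaken .last hσ.weaken ha.weaken))

theorem dec_forall_exists_hit {m : ∀ i, (I i).Move} {s : ∀ i, Fin (I i).nS}
    (hm : PolyComp (fun i => (I i).params) Γ fun i => encPair (m i))
    (hs : PolyComp (fun i => (I i).params) Γ fun i => encUnary (s i)) :
    PolyDec (fun i => (I i).params) Γ fun i =>
      ∀ a, ∃ s', (m i).2 s' = true ∧ (I i).weight (s i) (m i).1 a s' ≠ 0 :=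
  PolyDec.forall_fin (comp_nA hI) (bound_nA I)
    (dec_exists_hit (I := fun p : Σ i, Fin (I i).nA => I p.1) (m := fun p => m p.1)
      (s := fun p => s p.1) (a := fun p => p.2) hI.weaken hm.weaken hs.weaken .last)

/-- The encoding of an entry of the table of a partial positional strategy. -/
def encEntry {J : Instance} (f : J.Pos → Option J.Move) (v : J.Pos) : Data :=
  .cons (encPair v) (encOption encPair (f v))

section Strategy

variable {f : ∀ i, (I i).Pos → Option (I i).Move}
  (hf : PolyEnum (fun i => (I i).params) Γ (fun i => (I i).positions) fun i => encEntry (f i))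
include hf

/-- Whether a partial positional strategy is defined at a position is found by searching the table. -/
theorem dec_defined {v : ∀ i, (I i).Pos}
    (hv : PolyComp (fun i => (I i).params) Γ fun i => encPair (v i)) :
    PolyDec (fun i => (I i).params) Γ fun i => f i (v i) ≠ none := by
  refine (PolyDec.bex hf (P := fun i v' => v' = v i ∧ f i v' ≠ none) (PolyDec.and
    (dec_pos_eq (I := fun p : Σ i, (I i).Pos => I p.1) (v := fun p => p.2)
      (v' := fun p => v p.1) hI.weaken PolyComp.last.hd hv.weaken)
    ((PolyDec.isNil (b := fun p : Σ i, (I i).Pos => encOption encPair (f p.1 p.2))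
      PolyComp.last.tl).congr fun _ => encOption_eq_nil).not)).congr fun i => ?_
  constructor
  · rintro ⟨v', -, rfl, h⟩
    exact h
  · exact fun h => ⟨v i, mem_positions _ _, rfl, h⟩

theorem dec_good {v : ∀ i, (I i).Pos} {m : ∀ i, (I i).Move}
    (hv : PolyComp (fun i => (I i).params) Γ fun i => encPair (v i))
    (hm : PolyComp (fun i => (I i).params) Γ fun i => encPair (m i)) :
    PolyDec (fun i => (I i).params) Γ fun i =>
      (I i).Good (fun v' => f i v' ≠ none) (v i) (m i) := by
  have h₁ : PolyDec (fun i => (I i).params) Γ fun i => (m i).1 ∈ (I i).T.act (v i).1 :=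
    dec_act hI hm.hd hv.hd
  have h₂ : PolyDec (fun i => (I i).params) Γ fun i => ∀ s, (v i).2 s = true →
      ∀ a, ∃ s', (m i).2 s' = true ∧ (I i).weight s (m i).1 a s' ≠ 0 := by
    let I' := fun p : Σ i, Fin (I i).nS => I p.1
    exact PolyDec.forall_fin (comp_nS hI) (bound_nS I) (PolyDec.imp
      (dec_mem_set (I := I') (B := fun p => (v p.1).2) (s := fun p => p.2) hv.tl.weaken .last)
      (dec_forall_exists_hit (I := I') (m := fun p => m p.1) (s := fun p => p.2) hI.weaken
        hm.weaken .last))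
  have h₃ : PolyDec (fun i => (I i).params) Γ fun i => ∀ s, (m i).2 s = true →
      f i ((I i).nextPos (v i).1 (m i) (Quotient.mk (I i).arena.simE s)) ≠ none := by
    let I' := fun p : Σ i, Fin (I i).nS => I p.1
    exact PolyDec.forall_fin (comp_nS hI) (bound_nS I) (PolyDec.imp
      (dec_mem_set (I := I') (B := fun p => (m p.1).2) (s := fun p => p.2) hm.tl.weaken .last)
      (dec_defined (I := I') (f := fun p => f p.1) hI.weaken hf.weaken
        (comp_nextPos (I := I') (q := fun p => (v p.1).1) (m := fun p => m p.1)
          (s := fun p => p.2) hI.weaken hv.hd.weaken hm.weaken .last)))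
  exact h₁.and (h₂.and h₃)

open Classical in
/-- One round of the attractor computation. -/
theorem enum_improve : PolyEnum (fun i => (I i).params) Γ (fun i => (I i).positions) fun i =>
    encEntry fun v => (f i v).or
      ((I i).moves.find? fun m => decide ((I i).Good (fun v' => f i v' ≠ none) v m)) := by
  let I' := fun p : Σ i, (I i).Pos => I p.1
  refine PolyEnum.map hf (.cons PolyComp.last.hd ?_)
  have hI' : PolyComp (fun p => (I' p).params)
      (fun p => .cons (Γ p.1) (encEntry (f p.1) p.2)) fun p => (I' p).encode := hI.weaken
  have hf' : PolyEnum (fun p => (I' p).params) (fun p => .cons (Γ p.1) (encEntry (f p.1) p.2))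
      (fun p => (I' p).positions) fun p => encEntry (f p.1) := hf.weaken
  have hv : PolyComp (fun p => (I' p).params) (fun p => .cons (Γ p.1) (encEntry (f p.1) p.2))
      fun p => encPair p.2 := PolyComp.last.hd
  have hfind : PolyComp (fun p => (I' p).params)
      (fun p => .cons (Γ p.1) (encEntry (f p.1) p.2)) fun p =>
      encOption encPair ((I' p).moves.find? fun m =>
        decide ((I' p).Good (fun v' => f p.1 v' ≠ none) p.2 m)) :=
    PolyComp.find? (enum_moves hI')
      ((dec_good (I := fun p : Σ p, (I' p).Move => I' p.1) (f := fun p => f p.1.1)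
        (v := fun p => p.1.2) (m := fun p => p.2) hI'.weaken hf'.weaken
        hv.weaken .last).congr fun _ => decide_eq_true_iff.symm)
  refine (PolyComp.ite (PolyDec.isNil PolyComp.last.tl) hfind PolyComp.last.tl).congr ?_
  rintro ⟨i, v⟩
  simp only [encEntry, Data.tl, encOption_eq_nil]
  cases h : f i v <;> simp [I']

end Strategy

theorem enum_solution : PolyEnum (fun i => (I i).params) Γ (fun i => (I i).positions) fun i =>
    encEntry (I i).solution := by
  have h := PolyComp.iter (enum_positions hI)
    (fun i k => encList ((I i).positions.map (encEntry ((I i).choice k))))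
    (PolyComp.map (enum_positions hI) (g := fun i v => .cons (encPair v) .nil)
      (.cons .last .nil)) ?_
  · exact ⟨h, bound_positions I⟩
  · let J := fun p : Σ i, Fin (I i).positions.length => I p.1
    have hf : PolyEnum (fun p => (J p).params) (fun p => .cons (Γ p.1)
        (.cons (encList ((J p).positions.map (encEntry ((J p).choice p.2))))
          (encPair (J p).positions[p.2]))) (fun p => (J p).positions)
        (fun p => encEntry ((J p).choice p.2)) :=
      ⟨PolyComp.id.tl.hd, bound_positions J⟩
    exact (enum_improve (I := J) hI.weaken hf).list

theorem dec_initPos_mem_won : PolyDec (fun i => (I i).params) Γ fun i =>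
    ∀ s ∈ (I i).K, (I i).initPos (Quotient.mk (I i).arena.simE s) ∈ (I i).won :=
  PolyDec.forall_fin (comp_nS hI) (bound_nS I) (PolyDec.imp
    (dec_K (I := fun p : Σ i, Fin (I i).nS => I p.1) (s := fun p => p.2) hI.weaken .last)
    (dec_defined (I := fun p : Σ i, Fin (I i).nS => I p.1) (f := fun p => (I p.1).solution)
      hI.weaken (enum_solution hI).weaken
      (comp_initPos (I := fun p : Σ i, Fin (I i).nS => I p.1) (s := fun p => p.2)
        hI.weaken .last)))

theorem comp_index {v : ∀ i, (I i).Pos}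
    (hv : PolyComp (fun i => (I i).params) Γ fun i => encPair (v i)) :
    PolyComp (fun i => (I i).params) Γ fun i => encUnary ((I i).index (v i)) := by
  have hj := PolyEnum.finRange (PolyComp.length (enum_positions hI)) (bound_positions I)
  have htab : PolyComp (fun i => (I i).params) Γ fun i =>
      encTable fun j : Fin (I i).positions.length => encPair (I i).positions[j] :=
    (enum_positions hI).list.congr fun i => by
      rw [encTable]
      congr 1
      apply List.ext_getElem <;> simp
  let J := fun p : Σ i, Fin (I i).positions.length => I p.1
  have h := PolyComp.find? hj (P := fun i j => decide ((I i).positions[j] = v i))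
    ((dec_pos_eq (I := J) (v := fun p => (J p).positions[p.2]) (v' := fun p => v p.1) hI.weaken
      (PolyComp.get (f := fun p j => encPair (J p).positions[j]) (j := fun p => p.2) htab.weaken
        .last (bound_positions J)) hv.weaken).congr fun _ => decide_eq_true_iff.symm)
  refine h.hd.congr fun i => ?_
  rw [← Option.some_get ((I i).exists_index (v i))]
  rfl

/-- The recorded move, from the entry of a position in the solution table. -/
theorem comp_moveAt :
    PolyComp (fun p : Σ i, (I i).Pos => (I p.1).params)
      (fun p => .cons (Γ p.1) (encEntry (I p.1).solution p.2))
      fun p => encPair ((I p.1).moveAt p.2) := by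
  let J := fun p : Σ i, (I i).Pos => I p.1
  have hfalse : PolyComp (fun p => (J p).params)
      (fun p => .cons (Γ p.1) (encEntry (I p.1).solution p.2)) fun p =>
      encSet fun _ : Fin (J p).nS => false :=
    PolyComp.table (comp_nS (I := J) hI.weaken) (bound_nS J) .nil
  refine (PolyComp.ite (PolyDec.isNil PolyComp.last.tl) (PolyComp.cons .nil hfalse)
    PolyComp.last.tl.hd).congr ?_
  rintro ⟨i, v⟩
  simp only [encEntry, Data.tl, encOption_eq_nil, moveAt]
  cases h : (I i).solution v <;> simp [Data.hd, encOption, encPair, J]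
  rfl

/-- The tables of the memory automaton have a first row for its initial state, and one row for each
position. -/
theorem comp_memory : PolyComp (fun i => (I i).params) Γ fun i =>
    (I i).encodeMemory (I i).memory := by
  let J := fun p : Σ i, (I i).Pos => I p.1
  let J' := fun p : Σ p, Fin (J p).nS => J p.1
  have hnext₀ : PolyComp (fun i => (I i).params) Γ fun i => encTable fun s =>
      .cons .nil (encUnary ((I i).index ((I i).initPos (Quotient.mk (I i).arena.simE s)))) :=
    PolyComp.table (comp_nS hI) (bound_nS I) (.cons .nil
      (comp_index (I := fun p : Σ i, Fin (I i).nS => I p.1) hI.weaken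
        (comp_initPos (I := fun p : Σ i, Fin (I i).nS => I p.1) (s := fun p => p.2) hI.weaken
          .last)))
  have hnext : PolyComp (fun i => (I i).params) Γ fun i => encList ((I i).positions.map fun v =>
      encTable fun s => .cons .nil (encUnary ((I i).index ((I i).nextPos v.1 ((I i).moveAt v)
        (Quotient.mk (I i).arena.simE s))))) := by
    have hJ : PolyComp (fun p => (J p).params)
        (fun p => .cons (Γ p.1) (encEntry (I p.1).solution p.2)) fun p => (J p).encode :=
      hI.weaken
    have hq : PolyComp (fun p => (J p).params)
        (fun p => .cons (Γ p.1) (encEntry (I p.1).solution p.2)) fun p => encUnary p.2.1 :=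
      PolyComp.last.hd.hd
    exact PolyComp.map (enum_solution hI) (PolyComp.table (comp_nS hJ) (bound_nS J)
      (.cons .nil (comp_index (I := J') hJ.weaken
        (comp_nextPos (I := J') (q := fun p => p.1.2.1) (m := fun p => (J p.1).moveAt p.1.2)
          (s := fun p => p.2) hJ.weaken hq.weaken (comp_moveAt hI).weaken
          .last))))
  have hout : PolyComp (fun i => (I i).params) Γ fun i => encList ((I i).positions.map fun v =>
      encUnary ((I i).moveAt v).1) :=
    PolyComp.map (enum_solution hI) (comp_moveAt hI).hd
  have hlen := PolyComp.length (enum_positions hI)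
  refine ((PolyComp.cons .nil hlen).cons (PolyComp.nil.cons
    ((hnext₀.cons hnext).cons ((PolyComp.nil.cons hout).cons .nil)))).congr fun i => ?_
  have htab : ∀ {g : Fin ((I i).positions.length + 1) → Data} {h : (I i).Pos → Data} {d : Data},
      d = g 0 → (∀ j, h (I i).positions[j] = g (Fin.succ j)) →
      .cons d (encList ((I i).positions.map h)) = encTable g := by
    rintro g h d rfl hgh
    rw [encTable, List.ofFn_succ, encList]
    congr 2
    apply List.ext_getElem <;> simp [← hgh]
  rw [encodeMemory]
  refine congrArg₂ Data.cons rfl (congrArg₂ Data.cons rfl (congrArg₂ Data.cons ?_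
    (congrArg₂ Data.cons ?_ rfl)))
  · exact htab (g := fun k => encTable fun s =>
      encUnary ((I i).memory.next k (Quotient.mk (I i).arena.simE s))) rfl fun j => rfl
  · exact htab (g := fun k => encUnary ((I i).memory.out k)) rfl fun j => rfl

end Algorithm

end Instance

end ConcurrentGame

theorem mainTheorem3 :
    -- deciding the existence of a winning strategy
    (∃ (P : WhileLang.Prog) (p : MvPolynomial (Fin 4) ℕ),
      ∀ I : ConcurrentGame.Instance, I.arena.AdamPerfectlyInformed →
        P.ComputesWithin I.encode (WhileLang.encProp (∃ φ, I.WinningStrategy φ))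
          (I.timeBound p)) ∧
    -- constructing a winning finite-memory strategy, if there is a winning strategy
    (∃ (P : WhileLang.Prog) (p : MvPolynomial (Fin 4) ℕ) (m : MvPolynomial (Fin 2) ℕ),
      ∀ I : ConcurrentGame.Instance, I.arena.AdamPerfectlyInformed →
        (∃ φ, I.WinningStrategy φ) →
          ∃ M : ConcurrentGame.FiniteMemory I.arena.ObsE (Fin I.nE),
            P.ComputesWithin I.encode (I.encodeMemory M) (I.timeBound p) ∧
            M.size ≤ I.memoryBound m ∧
            I.WinningStrategy M.strategy) := by
  constructor
  · obtain ⟨P, p, h⟩ := ConcurrentGame.Instance.dec_initPos_mem_won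
      (I := fun I : ConcurrentGame.Instance => I) WhileLang.PolyComp.id
    refine ⟨P, p, fun I hA => ?_⟩
    rw [ConcurrentGame.Instance.exists_winningStrategy_iff hA]
    exact h I
  · obtain ⟨P, p, h⟩ := ConcurrentGame.Instance.comp_memory
      (I := fun I : ConcurrentGame.Instance => I) WhileLang.PolyComp.id
    refine ⟨P, p, .X 1 * .X 0 + .C 1, fun I hA hφ => ⟨I.memory, h I, ?_, ?_⟩⟩
    · change I.positions.length + 1 ≤ _
      simp [I.length_positions, ConcurrentGame.Instance.memoryBound]
    · exact ConcurrentGame.Instance.winningStrategy_memory hA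
        ((ConcurrentGame.Instance.exists_winningStrategy_iff hA).1 hφ)
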